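/- Let $n\ge 1$ be an integer and let $m\ge 1$ and $s>1/2$ be real numbers. Write $\langle x\rangle=(1+|x|^2)^{1/2}$. Let $a\in C^\infty(\mathbb R^n)$ be real-valued with only finitely many critical points, all of them nondegenerate, i.e. $$\nabla a(\xi)=0\ \Longrightarrow\ \det\nabla^2a(\xi)\neq 0 .$$ Let $a_m\in C^\infty(\mathbb R^n\setminus\{0\})$ be real-valued and positively homogeneous of order $m$, that is $a_m(\lambda\xi)=\lambda^m a_m(\xi)$ for $\lambda>0$, $\xi\ne0$. Assume that $a$ is dispersive for large $\xi$ with principal term $a_m$: there are constants $c,R>0$ and, for every multi-index $\alpha$, a constant $C_\alpha$ such that for all $|\xi|\ge R$ $$|\nabla a(\xi)|\ge c\,\langle\xi\rangle^{m-1},\qquad |\partial^\alpha(a-a_m)(\xi)|\le C_\alpha\langle\xi\rangle^{m-1-|\alpha|}.$$ Then there is a constant $C$, independent of $\varphi$, such that for all $\varphi\in L^2(\mathbb R^n)$ $$\big\|\langle x\rangle^{-s}\,|\nabla a(D_x)|^{1/2}e^{ita(D_x)}\varphi(x)\big\|_{L^2(\mathbb R_t\times\mathbb R^n_x)}\le C\,\|\varphi\|_{L^2(\mathbb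 R^n_x)} .$$ Here $D_x=-i\partial_x$, and $|\nabla a(D_x)|^{1/2}e^{ita(D_x)}\varphi$ is, for each $t$, the tempered distribution in $x$ whose Fourier transform is $|\nabla a(\xi)|^{1/2}e^{ita(\xi)}\widehat\varphi(\xi)$, with $\widehat\varphi(\xi)=\int e^{-ix\cdot\xi}\varphi(x)\,dx$; part of the claim is that for almost every $t$ it is a function of $x$, given by a function measurable in $(t,x)$. -/

import Mathlib

open MeasureTheory
open scoped FourierTransform SchwartzMap ContDiff NNReal ENNReal

noncomputable section

/-- The bracket `⟨x⟩ = (1 + |x|²)^{1/2}`. -/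
def japaneseBracket {n : ℕ} (x : EuclideanSpace ℝ (Fin n)) : ℝ :=
  Real.sqrt (1 + ‖x‖ ^ 2)

/-- The partial derivative `∂_{i 0} ∂_{i 1} ⋯ ∂_{i (k-1)} f (ξ)` of order `k`. As `i` runs over all
maps `Fin k → Fin n`, these are the derivatives `∂^α f (ξ)` over all multi-indices with `|α| = k`
(for smooth `f`). -/
def partialDerivative {n k : ℕ} (i : Fin k → Fin n) (f : EuclideanSpace ℝ (Fin n) → ℝ)
    (ξ : EuclideanSpace ℝ (Fin n)) : ℝ :=
  iteratedFDeriv ℝ k f ξ (fun j => EuclideanSpace.single (i j) (1 : ℝ))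

/-- The Hessian matrix `∇² f (ξ)`. -/
def hessianMatrix {n : ℕ} (f : EuclideanSpace ℝ (Fin n) → ℝ) (ξ : EuclideanSpace ℝ (Fin n)) :
    Matrix (Fin n) (Fin n) ℝ :=
  Matrix.of fun i j => partialDerivative ![i, j] f ξ

/-- A real-valued function that is smooth on `ℝⁿ ∖ 0` and positively homogeneous of order `m`.
Its value at the origin plays no role. -/
structure IsHomogeneousSymbol {n : ℕ} (m : ℝ) (b : EuclideanSpace ℝ (Fin n) → ℝ) : Prop where
  contDiffOn : ContDiffOn ℝ ∞ b {0}ᶜ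
  homogeneous : ∀ (c : ℝ) (ξ : EuclideanSpace ℝ (Fin n)), 0 < c → ξ ≠ 0 → b (c • ξ) = c ^ m * b ξ

/-- The symbol `a` with principal term `am` (of order `m`) is dispersive for large `ξ`:
`|∇a(ξ)| ≥ c ⟨ξ⟩^{m-1}` and `|∂^α (a - am)(ξ)| ≤ C_α ⟨ξ⟩^{m-1-|α|}` for `|ξ| ≥ R`. -/
structure IsDispersiveForLarge {n : ℕ} (m : ℝ) (a am : EuclideanSpace ℝ (Fin n) → ℝ) :
    Prop where
  principal : IsHomogeneousSymbol m am
  gradient_lower : ∃ c R : ℝ, 0 < c ∧ 0 < R ∧ ∀ ξ : EuclideanSpace ℝ (Fin n), R ≤ ‖ξ‖ →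
    c * japaneseBracket ξ ^ (m - 1) ≤ ‖gradient a ξ‖
  remainder : ∃ R : ℝ, 0 < R ∧ ∀ k : ℕ, ∃ C : ℝ, ∀ (i : Fin k → Fin n)
    (ξ : EuclideanSpace ℝ (Fin n)), R ≤ ‖ξ‖ →
      |partialDerivative i (fun η => a η - am η) ξ| ≤ C * japaneseBracket ξ ^ (m - 1 - (k : ℝ))

/-- The tempered distribution `T` is given by the function `f`: for every Schwartz function `ψ`
the product `ψ f` is integrable and `T ψ = ∫ ψ f`. -/
def IsGivenByFunction {n : ℕ} (T : 𝓢'(EuclideanSpace ℝ (Fin n), ℂ))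
    (f : EuclideanSpace ℝ (Fin n) → ℂ) : Prop :=
  ∀ ψ : 𝓢(EuclideanSpace ℝ (Fin n), ℂ),
    Integrable (fun x => ψ x * f x) ∧ T ψ = ∫ x, ψ x * f x

/-- `T = σ(D) φ` as a tempered distribution, for `φ ∈ L²` and the Fourier multiplier with symbol
`σ`, where `D = -i∂`. Mathlib's Fourier transform has kernel `e^{-2πi x·ξ}`, so `D` acts on the
Fourier side as multiplication by `2πξ`: the Fourier transform of `T` is `σ(2πξ) (𝓕 φ)(ξ)`.
This determines `T` uniquely. -/
def IsFourierMultiplierOf {n : ℕ} (σ : EuclideanSpace ℝ (Fin n) → ℂ)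
    (φ : Lp (α := EuclideanSpace ℝ (Fin n)) ℂ 2 volume)
    (T : 𝓢'(EuclideanSpace ℝ (Fin n), ℂ)) : Prop :=
  IsGivenByFunction (𝓕 T)
    (fun ξ => σ ((2 * Real.pi) • ξ) *
      ((𝓕 φ : Lp (α := EuclideanSpace ℝ (Fin n)) ℂ 2 volume) : EuclideanSpace ℝ (Fin n) → ℂ) ξ)

/-- The symbol `|∇a(ξ)|^{1/2} e^{i t a(ξ)}` of the operator `|∇a(D)|^{1/2} e^{i t a(D)}`. -/
def invariantSymbol {n : ℕ} (a : EuclideanSpace ℝ (Fin n) → ℝ) (t : ℝ)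
    (ξ : EuclideanSpace ℝ (Fin n)) : ℂ :=
  ((‖gradient a ξ‖ ^ (1 / 2 : ℝ) : ℝ) : ℂ) * Complex.exp (Complex.I * ((t * a ξ : ℝ) : ℂ))

/-- The estimate `‖⟨x⟩^{-s} |∇a(D)|^{1/2} e^{i t a(D)} φ‖_{L²(ℝ_t × ℝⁿ_x)} ≤ C ‖φ‖_{L²(ℝⁿ_x)}` for
a given `φ ∈ L²`: for every `t` the tempered distribution `u t = |∇a(D)|^{1/2} e^{i t a(D)} φ`
exists, for almost every `t` it is a function `v (t, ·)`, where `v` is measurable on `ℝ × ℝⁿ`, and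
the weighted norm of `v` is bounded as claimed. -/
def InvariantEstimate {n : ℕ} (a : EuclideanSpace ℝ (Fin n) → ℝ) (s : ℝ) (C : ℝ≥0)
    (φ : Lp (α := EuclideanSpace ℝ (Fin n)) ℂ 2 volume) : Prop :=
  ∃ u : ℝ → 𝓢'(EuclideanSpace ℝ (Fin n), ℂ),
    (∀ t : ℝ, IsFourierMultiplierOf (invariantSymbol a t) φ (u t)) ∧
    ∃ v : ℝ × EuclideanSpace ℝ (Fin n) → ℂ,
      AEStronglyMeasurable v volume ∧
      (∀ᵐ t : ℝ, IsGivenByFunction (u t) (fun x => v (t, x))) ∧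
      eLpNorm (fun p : ℝ × EuclideanSpace ℝ (Fin n) =>
        ((japaneseBracket p.2 ^ (-s) : ℝ) : ℂ) * v p) 2 volume ≤ (C : ℝ≥0∞) * ‖φ‖ₑ

end

/-! Write `f` for the Fourier transform of the data. Suppose `f` lives on a set Ω of frequencies on
which |e·∇a| ≥ c|∇a| > 0 for a unit vector e, and on which a is injective along lines parallel to e
(`TransversalOn`). Freeze r = e·x and view the solution as a function of t and the remaining
coordinates of x. Taking a(ξ) instead of e·ξ as a frequency coordinate, with Jacobian |e·∇a|, turns
it into an inverse Fourier transform. By Plancherel its squared norm for each r is ∫ |∇a| |f|² /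
|e·∇a| ≤ c⁻¹‖f‖², so the Jacobian pays exactly for the factor |∇a|^{1/2}
(`lintegral_evolution_exchange`). Since ⟨x⟩^{-2s} ≤ ⟨r⟩^{-2s} and s > 1/2, integration in r gives
the estimate (`TransversalOn.smoothingBoundOn`).

It remains to cover the noncritical frequencies by finitely many such sets. Near a noncritical point
a small ball works, with e along the gradient. Near a critical point the Hessian form is nonzero, so
there is a basis of directions on which it does not vanish; every gradient makes a controlled angle
with one of them, and the fixed sign of the second derivative in that direction gives injectivity
(`exists_hasTransversalCover_of_sndDeriv_ne_zero`). At infinity the rescaled gradient converges to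
∇a_m ≠ 0, so truncated convex cones work (`hasTransversalCover_infinity`). Compactness of a ball and
of the sphere makes the cover finite.

General L² data are reached by truncation in frequency (`exists_evolution_limit`), which also
produces the measurable representative. -/

set_option linter.unusedSectionVars false

/-! ### Plancherel's identity for the Fourier integral -/

section Plancherel

open scoped InnerProductSpace

variable {E : Type*} [NormedAddCommGroup E] [InnerProductSpace ℝ E] [FiniteDimensional ℝ E]
  [MeasurableSpace E] [BorelSpace E]

theorem integral_mul_fourier_eq {f g : E → ℂ} (hf : Integrable f) (hg : Integrable g) :
    ∫ ξ, 𝓕 f ξ * g ξ = ∫ x, f x * 𝓕 g x := by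
  have h := VectorFourier.integral_fourierIntegral_smul_eq_flip (L := innerₗ E)
    (μ := (volume : Measure E)) (ν := (volume : Measure E)) Real.continuous_fourierChar
    continuous_inner hf hg
  rw [flip_innerₗ] at h
  exact h

theorem continuous_fourier_of_integrable {f : E → ℂ} (hf : Integrable f) : Continuous (𝓕 f) :=
  VectorFourier.fourierIntegral_continuous (L := innerₗ E) Real.continuous_fourierChar
    continuous_inner hf

/-- The Fourier integral of a function in `L¹ ∩ L²` represents its `L²` Fourier transform. -/
theorem fourier_ae_eq_toLp_fourier {f : E → ℂ} (hf : Integrable f) (hf₂ : MemLp f 2) :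
    𝓕 f =ᵐ[volume] (𝓕 (hf₂.toLp f) : Lp (α := E) ℂ 2 volume) := by
  apply ae_eq_of_integral_contDiff_smul_eq (continuous_fourier_of_integrable hf).locallyIntegrable
  · exact (Lp.memLp _).locallyIntegrable (by norm_num)
  intro g hg hgc
  have hg₁ : HasCompactSupport (Complex.ofRealCLM ∘ g) := hgc.comp_left rfl
  have hg₂ : ContDiff ℝ ∞ (Complex.ofRealCLM ∘ g) := by fun_prop
  set ψ : 𝓢(E, ℂ) := hg₁.toSchwartzMap hg₂ with hψ
  have hψg : ∀ x, ψ x = (g x : ℂ) := fun x => rfl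
  -- The `L²` transform is characterised by duality with Schwartz functions, and the test function
  -- `ψ` is one.
  have key := DFunLike.congr_fun (Lp.fourier_toTemperedDistribution_eq (hf₂.toLp f)) ψ
  rw [TemperedDistribution.fourier_apply, Lp.toTemperedDistribution_apply,
    Lp.toTemperedDistribution_apply] at key
  calc ∫ x, g x • 𝓕 f x = ∫ x, 𝓕 f x * ψ x := by
        refine integral_congr_ae (Filter.Eventually.of_forall fun x => ?_)
        simp [hψg, mul_comm]
    _ = ∫ x, f x * 𝓕 (ψ : E → ℂ) x := integral_mul_fourier_eq hf ψ.integrable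
    _ = ∫ x, (𝓕 ψ) x • (hf₂.toLp f) x := by
        refine integral_congr_ae ?_
        filter_upwards [hf₂.coeFn_toLp] with x hx
        rw [hx, SchwartzMap.fourier_coe, smul_eq_mul, mul_comm]
    _ = _ := by
        rw [key]
        refine integral_congr_ae (Filter.Eventually.of_forall fun x => ?_)
        simp [hψg]

theorem eLpNorm_two_sq {α : Type*} {m : MeasurableSpace α} {μ : Measure α} (f : α → ℂ) :
    eLpNorm f 2 μ ^ 2 = ∫⁻ x, ‖f x‖ₑ ^ 2 ∂μ := by
  have := eLpNorm_nnreal_pow_eq_lintegral (f := f) (μ := μ) (p := 2) (by norm_num)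
  simpa using this

/-- Plancherel's identity for `L¹ ∩ L²`. -/
theorem lintegral_fourier_sq {f : E → ℂ} (hf : Integrable f) (hf₂ : MemLp f 2) :
    ∫⁻ y, ‖𝓕 f y‖ₑ ^ 2 = ∫⁻ x, ‖f x‖ₑ ^ 2 := by
  rw [← eLpNorm_two_sq, ← eLpNorm_two_sq, eLpNorm_congr_ae (fourier_ae_eq_toLp_fourier hf hf₂),
    ← eLpNorm_congr_ae hf₂.coeFn_toLp, ← Lp.enorm_def, ← Lp.enorm_def,
    ← ofReal_norm, ← ofReal_norm, Lp.norm_fourier_eq]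

theorem lintegral_fourierInv_sq {f : E → ℂ} (hf : Integrable f) (hf₂ : MemLp f 2) :
    ∫⁻ y, ‖𝓕⁻ f y‖ₑ ^ 2 = ∫⁻ x, ‖f x‖ₑ ^ 2 := by
  simp_rw [Real.fourierInv_eq_fourier_neg]
  rw [lintegral_neg_eq_self (fun y => ‖𝓕 f y‖ₑ ^ 2), lintegral_fourier_sq hf hf₂]

end Plancherel

/-! ### Exchanging time with a space coordinate, and straightening the symbol -/

section Evolution

open scoped InnerProductSpace

variable {E : Type*} [NormedAddCommGroup E] [InnerProductSpace ℝ E] [FiniteDimensional ℝ E]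
  [MeasurableSpace E] [BorelSpace E]

/-- The superposition `∫ e^{2πi (x·ξ + t β(ξ))} g(ξ) dξ` of plane waves. -/
noncomputable def evolution (β : E → ℝ) (g : E → ℂ) (p : ℝ × E) : ℂ :=
  ∫ ξ, Real.fourierChar (⟪ξ, p.2⟫_ℝ + p.1 * β ξ) • g ξ

/-- The involution of `ℝ × E` that exchanges `t` with the coordinate `⟪e, x⟫`. -/
noncomputable def exchange (e : E) : ℝ × E →ₗ[ℝ] ℝ × E :=
  LinearMap.prod (innerₗ E e ∘ₗ LinearMap.snd ℝ ℝ E)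
    (LinearMap.snd ℝ ℝ E + (LinearMap.fst ℝ ℝ E - innerₗ E e ∘ₗ LinearMap.snd ℝ ℝ E).smulRight e)

theorem exchange_apply (e : E) (p : ℝ × E) :
    exchange e p = (⟪e, p.2⟫_ℝ, p.2 + (p.1 - ⟪e, p.2⟫_ℝ) • e) := rfl

theorem inner_exchange_snd {e : E} (he : ‖e‖ = 1) (p : ℝ × E) :
    ⟪e, (exchange e p).2⟫_ℝ = p.1 := by
  simp [exchange_apply, inner_add_right, inner_smul_right, he]

theorem exchange_exchange {e : E} (he : ‖e‖ = 1) (p : ℝ × E) :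
    exchange e (exchange e p) = p := by
  rw [exchange_apply e (exchange e p), inner_exchange_snd he]
  ext1
  · rfl
  · simp only [exchange_apply]
    module

theorem continuous_exchange (e : E) : Continuous (exchange e) :=
  LinearMap.continuous_of_finiteDimensional _

/-- A linear involution has determinant ±1. -/
theorem measurePreserving_exchange {e : E} (he : ‖e‖ = 1) :
    MeasurePreserving (exchange e) (volume : Measure (ℝ × E)) volume := by
  refine ⟨(continuous_exchange e).measurable, ?_⟩
  have : (volume : Measure (ℝ × E)).IsAddHaarMeasure := by
    rw [Measure.volume_eq_prod]; infer_instance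
  have hdet : LinearMap.det (exchange e) * LinearMap.det (exchange e) = 1 := by
    rw [← LinearMap.det_comp, ← LinearMap.det_id (A := ℝ) (M := ℝ × E)]
    congr 1
    exact LinearMap.ext (exchange_exchange he)
  have h0 : LinearMap.det (exchange e) ≠ 0 := by
    intro h; simp [h] at hdet
  rw [Measure.map_linearMap_addHaar_eq_smul_addHaar _ h0]
  rcases mul_self_eq_one_iff.mp hdet with h | h <;> simp [h]

theorem continuous_evolution {β : E → ℝ} (hβ : Continuous β) {g : E → ℂ} (hg : Integrable g) :
    Continuous (evolution β g) := by
  refine continuous_of_dominated (bound := fun ξ => ‖g ξ‖) (fun p => ?_) (fun p => ?_) hg.norm ?_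
  · have hθ : Continuous fun ξ : E => ⟪ξ, p.2⟫_ℝ + p.1 * β ξ := by fun_prop
    exact AEStronglyMeasurable.smul (f := fun ξ => Real.fourierChar (⟪ξ, p.2⟫_ℝ + p.1 * β ξ))
      (Real.continuous_fourierChar.comp hθ).aestronglyMeasurable hg.aestronglyMeasurable
  · exact Filter.Eventually.of_forall fun ξ => (Circle.norm_smul _ _).le
  · refine Filter.Eventually.of_forall fun ξ => ?_
    have hθ : Continuous fun p : ℝ × E => ⟪ξ, p.2⟫_ℝ + p.1 * β ξ := by fun_prop
    exact (Real.continuous_fourierChar.comp hθ).smul continuous_const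

theorem integrable_fourierChar_smul {θ : E → ℝ} (hθ : Continuous θ) {g : E → ℂ}
    (hg : Integrable g) : Integrable fun ξ => Real.fourierChar (θ ξ) • g ξ := by
  refine hg.mono ?_ (Filter.Eventually.of_forall fun ξ => (Circle.norm_smul _ _).le)
  exact AEStronglyMeasurable.smul (f := fun ξ => Real.fourierChar (θ ξ))
    (Real.continuous_fourierChar.comp hθ).aestronglyMeasurable hg.aestronglyMeasurable

theorem evolution_add {β : E → ℝ} (hβ : Continuous β) {g₁ g₂ : E → ℂ} (h₁ : Integrable g₁)
    (h₂ : Integrable g₂) (p : ℝ × E) :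
    evolution β (fun ξ => g₁ ξ + g₂ ξ) p = evolution β g₁ p + evolution β g₂ p := by
  have hθ : Continuous fun ξ : E => ⟪ξ, p.2⟫_ℝ + p.1 * β ξ := by fun_prop
  simp only [evolution, smul_add]
  exact integral_add (integrable_fourierChar_smul hθ h₁) (integrable_fourierChar_smul hθ h₂)

theorem evolution_sub {β : E → ℝ} (hβ : Continuous β) {g₁ g₂ : E → ℂ} (h₁ : Integrable g₁)
    (h₂ : Integrable g₂) (p : ℝ × E) :
    evolution β (fun ξ => g₁ ξ - g₂ ξ) p = evolution β g₁ p - evolution β g₂ p := by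
  have hθ : Continuous fun ξ : E => ⟪ξ, p.2⟫_ℝ + p.1 * β ξ := by fun_prop
  simp only [evolution, smul_sub]
  exact integral_sub (integrable_fourierChar_smul hθ h₁) (integrable_fourierChar_smul hθ h₂)

/-- On `Ω` the gradient of `β` makes an angle bounded away from `π/2` with the line spanned by the
unit vector `e`, and `β` is injective on the part in `Ω` of every line parallel to `e`. -/
structure TransversalOn (β : E → ℝ) (e : E) (c : ℝ) (Ω : Set E) : Prop where
  measurableSet : MeasurableSet Ω
  norm_eq_one : ‖e‖ = 1
  pos : 0 < c
  gradient_ne_zero : ∀ ξ ∈ Ω, gradient β ξ ≠ 0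
  le_abs_inner : ∀ ξ ∈ Ω, c * ‖gradient β ξ‖ ≤ |⟪e, gradient β ξ⟫_ℝ|
  ne_of_pos : ∀ ξ ∈ Ω, ∀ t : ℝ, 0 < t → ξ + t • e ∈ Ω → β (ξ + t • e) ≠ β ξ

/-- The map that replaces the coordinate of `ξ` in the direction `e` by `β ξ`. -/
noncomputable def straighten (β : E → ℝ) (e ξ : E) : E := ξ + (β ξ - ⟪e, ξ⟫_ℝ) • e

theorem inner_straighten {β : E → ℝ} {e : E} (he : ‖e‖ = 1) (ξ : E) :
    ⟪e, straighten β e ξ⟫_ℝ = β ξ := by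
  simp [straighten, inner_add_right, inner_smul_right, he]

/-- The derivative of `straighten β e`. -/
noncomputable def straightenDeriv (β : E → ℝ) (e ξ : E) : E →L[ℝ] E :=
  ContinuousLinearMap.id ℝ E + (innerSL ℝ (gradient β ξ) - innerSL ℝ e).smulRight e

theorem hasFDerivAt_straighten {β : E → ℝ} (hβ : Differentiable ℝ β) (e ξ : E) :
    HasFDerivAt (straighten β e) (straightenDeriv β e ξ) ξ := by
  have h₁ : HasFDerivAt β (innerSL ℝ (gradient β ξ)) ξ := (hβ ξ).hasGradientAt.hasFDerivAt
  have h₂ : HasFDerivAt (fun ξ : E => ⟪e, ξ⟫_ℝ) (innerSL ℝ e) ξ := (innerSL ℝ e).hasFDerivAt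
  exact (hasFDerivAt_id ξ).add ((h₁.sub h₂).smul_const e)

/-- The derivative is the identity plus a rank one map, so its determinant is 1 plus the value of
the functional at `e`. -/
theorem det_straightenDeriv (β : E → ℝ) {e : E} (he : ‖e‖ = 1) (ξ : E) :
    (straightenDeriv β e ξ).det = ⟪e, gradient β ξ⟫_ℝ := by
  have := LinearMap.transvection.det
    ((innerSL ℝ (gradient β ξ) - innerSL ℝ e : E →L[ℝ] ℝ) : Module.Dual ℝ E) e
  have hval : (innerSL ℝ (gradient β ξ) - innerSL ℝ e : E →L[ℝ] ℝ) e =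
      ⟪e, gradient β ξ⟫_ℝ - 1 := by
    rw [sub_apply, innerSL_apply_apply, innerSL_apply_apply,
      real_inner_comm, real_inner_self_eq_norm_sq, he, one_pow]
  calc (straightenDeriv β e ξ).det = _ := this
    _ = 1 + (innerSL ℝ (gradient β ξ) - innerSL ℝ e : E →L[ℝ] ℝ) e := rfl
    _ = _ := by rw [hval]; ring

/-- Two points with the same image lie on one line parallel to `e`, and `β` takes the same value at
both. -/
theorem TransversalOn.injOn_straighten {β : E → ℝ} {e : E} {c : ℝ} {Ω : Set E}
    (h : TransversalOn β e c Ω) : Set.InjOn (straighten β e) Ω := by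
  intro ξ hξ η hη hΦ
  have hβ : β ξ = β η := by
    rw [← inner_straighten (β := β) h.norm_eq_one ξ, hΦ, inner_straighten h.norm_eq_one]
  have hline : ξ = η + (⟪e, ξ⟫_ℝ - ⟪e, η⟫_ℝ) • e := by
    simp only [straighten, hβ] at hΦ
    rw [← sub_eq_zero] at hΦ ⊢
    rw [← hΦ]
    module
  have hline' : η = ξ + (⟪e, η⟫_ℝ - ⟪e, ξ⟫_ℝ) • e := by
    rw [← sub_eq_zero] at hline ⊢
    rw [← neg_eq_zero, ← hline]
    module
  rcases lt_trichotomy ⟪e, ξ⟫_ℝ ⟪e, η⟫_ℝ with hlt | heq | hlt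
  · refine absurd ?_ (h.ne_of_pos ξ hξ _ (sub_pos.mpr hlt) (hline' ▸ hη))
    rw [← hline', hβ]
  · rw [heq] at hline; simpa using hline
  · refine absurd ?_ (h.ne_of_pos η hη _ (sub_pos.mpr hlt) (hline ▸ hξ))
    rw [← hline, hβ]

/-- After the exchange `r` enters only through a unimodular factor, which is invisible to
Plancherel. -/
theorem evolution_exchange (β : E → ℝ) (g : E → ℂ) (e : E) (r : ℝ) (y : E) :
    evolution β g (exchange e (r, y)) =
      ∫ ξ, Real.fourierChar ⟪straighten β e ξ, y⟫_ℝ •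
        Real.fourierChar (r * ⟪e, ξ⟫_ℝ) • g ξ := by
  refine integral_congr_ae (Filter.Eventually.of_forall fun ξ => ?_)
  simp only [smul_smul, ← AddChar.map_add_eq_mul]
  congr 2
  simp only [exchange_apply, straighten, inner_add_left, inner_add_right, inner_smul_left,
    inner_smul_right, real_inner_comm ξ e]
  simp
  ring

/-- On the hyperplane `⟪e, x⟫ = r`, the evolution of data carried by a transversal set is the
Fourier transform of its image under `straighten β e`. -/
theorem lintegral_evolution_exchange {β : E → ℝ} (hβ : Differentiable ℝ β) {e : E} {c : ℝ}
    {Ω : Set E} (hΩ : TransversalOn β e c Ω) {g : E → ℂ} (hg : Integrable g)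
    (hsupp : ∀ ξ ∉ Ω, g ξ = 0)
    (hfin : ∫⁻ ξ in Ω, ‖g ξ‖ₑ ^ 2 / ENNReal.ofReal |⟪e, gradient β ξ⟫_ℝ| ≠ ⊤) (r : ℝ) :
    ∫⁻ y, ‖evolution β g (exchange e (r, y))‖ₑ ^ 2 =
      ∫⁻ ξ in Ω, ‖g ξ‖ₑ ^ 2 / ENNReal.ofReal |⟪e, gradient β ξ⟫_ℝ| := by
  classical
  set Φ := straighten β e
  set J : E → ℝ := fun ξ => |⟪e, gradient β ξ⟫_ℝ| with hJ
  set g' : E → ℂ := fun ξ => Real.fourierChar (r * ⟪e, ξ⟫_ℝ) • g ξ with hg'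
  have hg'int : Integrable g' := integrable_fourierChar_smul (by fun_prop) hg
  have hdet : ∀ ξ, |(straightenDeriv β e ξ).det| = J ξ := fun ξ => by
    rw [det_straightenDeriv β hΩ.norm_eq_one]
  have hJpos : ∀ ξ ∈ Ω, 0 < J ξ := fun ξ hξ =>
    (mul_pos hΩ.pos (norm_pos_iff.mpr (hΩ.gradient_ne_zero ξ hξ))).trans_le (hΩ.le_abs_inner ξ hξ)
  have hinj := hΩ.injOn_straighten
  have hder : ∀ ξ ∈ Ω, HasFDerivWithinAt Φ (straightenDeriv β e ξ) Ω ξ := fun ξ _ =>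
    (hasFDerivAt_straighten hβ e ξ).hasFDerivWithinAt
  have himg : MeasurableSet (Φ '' Ω) :=
    measurable_image_of_fderivWithin hΩ.measurableSet hder hinj
  -- The data transported to the image of Ω and divided by the Jacobian: its inverse Fourier
  -- transform is the evolution on the hyperplane.
  set G₀ : E → ℂ := fun η => (J (Function.invFunOn Φ Ω η))⁻¹ • g' (Function.invFunOn Φ Ω η)
  set G : E → ℂ := (Φ '' Ω).indicator G₀ with hG
  have hG₀ : ∀ ξ ∈ Ω, G₀ (Φ ξ) = (J ξ)⁻¹ • g' ξ := fun ξ hξ => by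
    have : Function.invFunOn Φ Ω (Φ ξ) = ξ := hinj.leftInvOn_invFunOn hξ
    simp only [G₀, this]
  have hGΦ : ∀ ξ ∈ Ω, J ξ • G₀ (Φ ξ) = g' ξ := fun ξ hξ => by
    rw [hG₀ ξ hξ, smul_smul, mul_inv_cancel₀ (hJpos ξ hξ).ne', one_smul]
  have hGint : Integrable G := by
    rw [hG, integrable_indicator_iff himg,
      integrableOn_image_iff_integrableOn_abs_det_fderiv_smul volume hΩ.measurableSet hder hinj]
    refine hg'int.integrableOn.congr_fun (fun ξ hξ => ?_) hΩ.measurableSet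
    simp only [hdet]
    exact (hGΦ ξ hξ).symm
  -- Squaring `G₀` gives two factors `J⁻¹`; the change of variables cancels one of them.
  have hGsq : ∫⁻ η, ‖G η‖ₑ ^ 2 = ∫⁻ ξ in Ω, ‖g ξ‖ₑ ^ 2 / ENNReal.ofReal (J ξ) := by
    have : (fun η => ‖G η‖ₑ ^ 2) = (Φ '' Ω).indicator fun η => ‖G₀ η‖ₑ ^ 2 := by
      ext η
      by_cases hη : η ∈ Φ '' Ω <;> simp [hG, hη]
    rw [this, lintegral_indicator himg,
      lintegral_image_eq_lintegral_abs_det_fderiv_mul volume hΩ.measurableSet hder hinj]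
    refine setLIntegral_congr_fun hΩ.measurableSet fun ξ hξ => ?_
    have h0 : ENNReal.ofReal (J ξ) ≠ 0 := by simpa using hJpos ξ hξ
    have hn : ‖g' ξ‖ₑ = ‖g ξ‖ₑ := by
      rw [← ofReal_norm, ← ofReal_norm, hg', Circle.norm_smul]
    simp only [hdet]
    rw [hG₀ ξ hξ, enorm_smul, hn, mul_pow, Real.enorm_of_nonneg (inv_pos.mpr (hJpos ξ hξ)).le,
      ENNReal.ofReal_inv_of_pos (hJpos ξ hξ), pow_two (ENNReal.ofReal (J ξ))⁻¹, mul_assoc,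
      ← mul_assoc, ENNReal.mul_inv_cancel h0 ENNReal.ofReal_ne_top, one_mul, mul_comm,
      div_eq_mul_inv]
  have hGmem : MemLp G 2 := by
    refine ⟨hGint.aestronglyMeasurable, ?_⟩
    have : eLpNorm G 2 volume ^ 2 < ⊤ := by
      rw [eLpNorm_two_sq, hGsq]; exact hfin.lt_top
    exact (ENNReal.pow_lt_top_iff.mp this).resolve_right two_ne_zero
  have hV : ∀ y, evolution β g (exchange e (r, y)) = 𝓕⁻ G y := by
    intro y
    rw [evolution_exchange, Real.fourierInv_eq]
    have h₁ : (fun η => Real.fourierChar ⟪η, y⟫_ℝ • G η) =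
        (Φ '' Ω).indicator fun η => Real.fourierChar ⟪η, y⟫_ℝ • G₀ η := by
      ext η
      by_cases hη : η ∈ Φ '' Ω <;> simp [hG, hη]
    rw [h₁, integral_indicator himg,
      integral_image_eq_integral_abs_det_fderiv_smul volume hΩ.measurableSet hder hinj,
      ← setIntegral_eq_integral_of_forall_compl_eq_zero (s := Ω)
        (fun ξ hξ => by rw [hsupp ξ hξ]; simp)]
    refine setIntegral_congr_fun hΩ.measurableSet fun ξ hξ => ?_
    simp only [hdet]
    rw [smul_comm (J ξ), hGΦ ξ hξ]
  simp_rw [hV]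
  rw [lintegral_fourierInv_sq hGint hGmem, hGsq]

end Evolution

/-! ### The weighted estimate on transversal sets and their finite unions -/

section SmoothingBound

open scoped InnerProductSpace

variable {E : Type*} [NormedAddCommGroup E] [InnerProductSpace ℝ E] [FiniteDimensional ℝ E]
  [MeasurableSpace E] [BorelSpace E]

/-- The function `|∇β|^{1/2} f`. -/
noncomputable def gradientSqrtMul (β : E → ℝ) (f : E → ℂ) (ξ : E) : ℂ :=
  ((‖gradient β ξ‖ ^ (1 / 2 : ℝ) : ℝ) : ℂ) * f ξ

/-- The weighted `L²(ℝ × E)` estimate for the evolution with data whose Fourier transform vanishes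
off `S`. -/
def SmoothingBoundOn (β : E → ℝ) (s : ℝ) (S : Set E) : Prop :=
  ∃ C : ℝ≥0, ∀ f : E → ℂ, MemLp f 2 → Integrable (gradientSqrtMul β f) → (∀ ξ ∉ S, f ξ = 0) →
    eLpNorm (fun p : ℝ × E => (((1 + ‖p.2‖ ^ 2) ^ (-s / 2) : ℝ) : ℂ) *
      evolution β (gradientSqrtMul β f) p) 2 volume ≤ C * eLpNorm f 2 volume

theorem ENNReal.le_of_sq_le_sq {x y : ℝ≥0∞} (h : x ^ 2 ≤ y ^ 2) : x ≤ y := by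
  by_contra! hlt
  exact absurd h (not_le.mpr (ENNReal.pow_lt_pow_left two_ne_zero hlt))

theorem enorm_gradientSqrtMul_sq (β : E → ℝ) (f : E → ℂ) (ξ : E) :
    ‖gradientSqrtMul β f ξ‖ₑ ^ 2 = ENNReal.ofReal ‖gradient β ξ‖ * ‖f ξ‖ₑ ^ 2 := by
  have h : ((‖gradient β ξ‖ ^ (1 / 2 : ℝ)) ^ 2 : ℝ) = ‖gradient β ξ‖ := by
    rw [← Real.rpow_natCast, ← Real.rpow_mul (norm_nonneg _)]; norm_num
  rw [gradientSqrtMul, enorm_mul, mul_pow, ← ofReal_norm (((_ : ℝ) : ℂ)), Complex.norm_real,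
    Real.norm_of_nonneg (by positivity), ← ENNReal.ofReal_pow (by positivity), h]

theorem TransversalOn.lintegral_div_le {β : E → ℝ} {e : E} {c : ℝ} {Ω : Set E}
    (hΩ : TransversalOn β e c Ω) (f : E → ℂ) :
    ∫⁻ ξ in Ω, ‖gradientSqrtMul β f ξ‖ₑ ^ 2 / ENNReal.ofReal |⟪e, gradient β ξ⟫_ℝ| ≤
      ENNReal.ofReal c⁻¹ * ∫⁻ ξ, ‖f ξ‖ₑ ^ 2 := by
  rw [← lintegral_const_mul' _ _ ENNReal.ofReal_ne_top]
  refine (setLIntegral_mono' hΩ.measurableSet fun ξ hξ => ?_).trans (setLIntegral_le_lintegral _ _)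
  have hg : 0 < ‖gradient β ξ‖ := norm_pos_iff.mpr (hΩ.gradient_ne_zero ξ hξ)
  have hle := hΩ.le_abs_inner ξ hξ
  have hpos : 0 < |⟪e, gradient β ξ⟫_ℝ| := (mul_pos hΩ.pos hg).trans_le hle
  rw [enorm_gradientSqrtMul_sq, div_eq_mul_inv, mul_right_comm,
    ← ENNReal.ofReal_inv_of_pos hpos, ← ENNReal.ofReal_mul hg.le]
  gcongr
  rw [← div_eq_mul_inv, div_le_iff₀ hpos, inv_mul_eq_div, le_div_iff₀ hΩ.pos]
  linarith

/-- The hyperplane norm does not depend on `r`, so the weight, bounded by a function of `r` alone,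
factors out of the integral. -/
theorem TransversalOn.smoothingBoundOn {β : E → ℝ} (hβ : Differentiable ℝ β) {e : E} {c : ℝ}
    {Ω : Set E} (hΩ : TransversalOn β e c Ω) {s : ℝ} (hs : 1 / 2 < s) :
    SmoothingBoundOn β s Ω := by
  -- The squared weight as a function of `r = ⟪e, x⟫`; it is integrable on the line because `2 * s >
  -- 1`.
  set W : ℝ → ℝ≥0∞ := fun r => ENNReal.ofReal ((1 + ‖r‖ ^ 2) ^ (-(2 * s) / 2)) with hW
  have hWfin : ∫⁻ r, W r ≠ ⊤ := by
    have hint : Integrable fun r : ℝ => (1 + ‖r‖ ^ 2) ^ (-(2 * s) / 2) :=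
      integrable_rpow_neg_one_add_norm_sq (by simp; linarith)
    exact hint.lintegral_lt_top.ne
  set K : ℝ≥0∞ := (∫⁻ r, W r) * ENNReal.ofReal c⁻¹ with hK
  have hKfin : K ≠ ⊤ := ENNReal.mul_ne_top hWfin ENNReal.ofReal_ne_top
  refine ⟨NNReal.sqrt K.toNNReal, fun f hf hg hsupp => ENNReal.le_of_sq_le_sq ?_⟩
  set g := gradientSqrtMul β f with hgdef
  have hcont : Continuous (evolution β g) := continuous_evolution hβ.continuous hg
  have hsq : ((NNReal.sqrt K.toNNReal : ℝ≥0) : ℝ≥0∞) ^ 2 = K := by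
    rw [← ENNReal.coe_pow, NNReal.sq_sqrt, ENNReal.coe_toNNReal hKfin]
  have hA := hΩ.lintegral_div_le f
  have hf₂ : ∫⁻ ξ, ‖f ξ‖ₑ ^ 2 ≠ ⊤ := by
    rw [← eLpNorm_two_sq]; exact ENNReal.pow_ne_top hf.eLpNorm_ne_top
  have hAfin := (hA.trans_lt (ENNReal.mul_lt_top ENNReal.ofReal_lt_top hf₂.lt_top)).ne
  have hWm : Measurable W := by
    refine ENNReal.measurable_ofReal.comp (Continuous.measurable ?_)
    exact Continuous.rpow_const (by fun_prop) fun r => Or.inl (by positivity)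
  rw [mul_pow, hsq, eLpNorm_two_sq, eLpNorm_two_sq]
  calc ∫⁻ p : ℝ × E, ‖(((1 + ‖p.2‖ ^ 2) ^ (-s / 2) : ℝ) : ℂ) * evolution β g p‖ₑ ^ 2
      ≤ ∫⁻ p : ℝ × E, W ⟪e, p.2⟫_ℝ * ‖evolution β g p‖ₑ ^ 2 := by
        refine lintegral_mono fun p => ?_
        simp only [enorm_mul, mul_pow]
        gcongr
        rw [← ofReal_norm, Complex.norm_real, Real.norm_of_nonneg (by positivity),
          ← ENNReal.ofReal_pow (by positivity), hW]
        refine ENNReal.ofReal_le_ofReal ?_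
        have h₁ : ((1 + ‖p.2‖ ^ 2) ^ (-s / 2) : ℝ) ^ 2 = (1 + ‖p.2‖ ^ 2) ^ (-(2 * s) / 2) := by
          rw [← Real.rpow_natCast, ← Real.rpow_mul (by positivity)]
          congr 1; push_cast; ring
        rw [h₁]
        refine Real.rpow_le_rpow_of_nonpos (by positivity) ?_ (by linarith)
        gcongr
        have := norm_inner_le_norm (𝕜 := ℝ) e p.2
        rwa [hΩ.norm_eq_one, one_mul] at this
    _ = ∫⁻ p : ℝ × E, W p.1 * ‖evolution β g (exchange e p)‖ₑ ^ 2 := by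
        rw [← (measurePreserving_exchange hΩ.norm_eq_one).lintegral_comp]
        · simp_rw [inner_exchange_snd hΩ.norm_eq_one]
        · exact (hWm.comp (by fun_prop)).mul (hcont.measurable.enorm.pow_const 2)
    _ = ∫⁻ r, ∫⁻ y : E, W r * ‖evolution β g (exchange e (r, y))‖ₑ ^ 2 := by
        rw [Measure.volume_eq_prod, lintegral_prod]
        exact ((hWm.comp measurable_fst).mul ((hcont.comp
          (continuous_exchange e)).measurable.enorm.pow_const 2)).aemeasurable
    _ = ∫⁻ r, W r * ∫⁻ ξ in Ω, ‖g ξ‖ₑ ^ 2 / ENNReal.ofReal |⟪e, gradient β ξ⟫_ℝ| := by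
        refine lintegral_congr fun r => ?_
        rw [lintegral_const_mul' _ _ ENNReal.ofReal_ne_top,
          lintegral_evolution_exchange hβ hΩ hg (fun ξ hξ => ?_) hAfin]
        simp [hgdef, gradientSqrtMul, hsupp ξ hξ]
    _ = (∫⁻ r, W r) * ∫⁻ ξ in Ω, ‖g ξ‖ₑ ^ 2 / ENNReal.ofReal |⟪e, gradient β ξ⟫_ℝ| :=
        lintegral_mul_const _ hWm
    _ ≤ K * ∫⁻ ξ, ‖f ξ‖ₑ ^ 2 := by
        rw [hK, mul_assoc]
        gcongr

theorem integrable_gradientSqrtMul_indicator {β : E → ℝ} {f : E → ℂ}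
    (hf : Integrable (gradientSqrtMul β f)) {S : Set E} (hS : MeasurableSet S) :
    Integrable (gradientSqrtMul β (S.indicator f)) := by
  convert! hf.indicator hS using 1
  ext ξ
  by_cases h : ξ ∈ S <;> simp [gradientSqrtMul, h]

theorem aestronglyMeasurable_weight_mul {s : ℝ} {u : ℝ × E → ℂ} (hu : Continuous u) :
    AEStronglyMeasurable
      (fun p : ℝ × E => (((1 + ‖p.2‖ ^ 2) ^ (-s / 2) : ℝ) : ℂ) * u p) volume := by
  refine Continuous.aestronglyMeasurable (Continuous.mul ?_ hu)
  exact Complex.continuous_ofReal.comp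
    (Continuous.rpow_const (by fun_prop) fun r => Or.inl (by positivity))

theorem SmoothingBoundOn.union {β : E → ℝ} (hβ : Continuous β) {s : ℝ} {S T : Set E}
    (hS : SmoothingBoundOn β s S) (hSm : MeasurableSet S) (hT : SmoothingBoundOn β s T) :
    SmoothingBoundOn β s (S ∪ T) := by
  obtain ⟨C₁, h₁⟩ := hS
  obtain ⟨C₂, h₂⟩ := hT
  refine ⟨C₁ + C₂, fun f hf hg hsupp => ?_⟩
  have hg₁ := integrable_gradientSqrtMul_indicator hg hSm
  have hg₂ := integrable_gradientSqrtMul_indicator hg hSm.compl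
  have b₁ := h₁ _ (hf.indicator hSm) hg₁ fun ξ hξ => by simp [hξ]
  have b₂ := h₂ _ (hf.indicator hSm.compl) hg₂ fun ξ hξ => by
    by_cases h : ξ ∈ S
    · simp [h]
    · simp [h, hsupp ξ (by simp [h, hξ])]
  have hsplit : gradientSqrtMul β f = fun ξ => gradientSqrtMul β (S.indicator f) ξ +
      gradientSqrtMul β (Sᶜ.indicator f) ξ := by
    ext ξ
    by_cases h : ξ ∈ S <;> simp [gradientSqrtMul, h]
  have hev : (fun p : ℝ × E => (((1 + ‖p.2‖ ^ 2) ^ (-s / 2) : ℝ) : ℂ) *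
      evolution β (gradientSqrtMul β f) p) =
      (fun p : ℝ × E => (((1 + ‖p.2‖ ^ 2) ^ (-s / 2) : ℝ) : ℂ) *
        evolution β (gradientSqrtMul β (S.indicator f)) p) +
      fun p : ℝ × E => (((1 + ‖p.2‖ ^ 2) ^ (-s / 2) : ℝ) : ℂ) *
        evolution β (gradientSqrtMul β (Sᶜ.indicator f)) p := by
    ext p
    rw [hsplit, evolution_add hβ hg₁ hg₂, mul_add]
    rfl
  rw [hev]
  refine (eLpNorm_add_le (aestronglyMeasurable_weight_mul (continuous_evolution hβ hg₁))
    (aestronglyMeasurable_weight_mul (continuous_evolution hβ hg₂)) (by norm_num)).trans ?_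
  rw [ENNReal.coe_add, add_mul]
  refine add_le_add (b₁.trans ?_) (b₂.trans ?_) <;> gcongr <;> exact eLpNorm_indicator_le _

theorem smoothingBoundOn_sUnion {β : E → ℝ} (hβ : Differentiable ℝ β) {s : ℝ} (hs : 1 / 2 < s)
    {T : Set (Set E)} (hT : T.Finite) (h : ∀ Ω ∈ T, ∃ e c, TransversalOn β e c Ω) :
    SmoothingBoundOn β s (⋃₀ T) := by
  induction T, hT using Set.Finite.induction_on with
  | empty =>
    refine ⟨0, fun f _ _ hf => ?_⟩
    have : gradientSqrtMul β f = 0 := by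
      ext ξ; simp [gradientSqrtMul, hf ξ (by simp)]
    simp [this, evolution]
  | @insert Ω T _ _ ih =>
    obtain ⟨e, c, hΩ⟩ := h Ω (Set.mem_insert _ _)
    rw [Set.sUnion_insert]
    exact (hΩ.smoothingBoundOn hβ hs).union hβ.continuous hΩ.measurableSet
      (ih fun Ω' hΩ' => h Ω' (Set.mem_insert_of_mem _ hΩ'))

/-- At critical points the factor `|∇β|^{1/2}` vanishes, so data there do not contribute. -/
theorem SmoothingBoundOn.univ_of_gradient_ne_zero {β : E → ℝ} {s : ℝ} {S : Set E}
    (h : SmoothingBoundOn β s S) (hS : MeasurableSet S) (hsub : {ξ | gradient β ξ ≠ 0} ⊆ S) :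
    SmoothingBoundOn β s Set.univ := by
  obtain ⟨C, h⟩ := h
  refine ⟨C, fun f hf hg _ => ?_⟩
  have heq : gradientSqrtMul β (S.indicator f) = gradientSqrtMul β f := by
    ext ξ
    by_cases hξ : ξ ∈ S
    · simp [gradientSqrtMul, hξ]
    · have : gradient β ξ = 0 := by_contra fun h0 => hξ (hsub h0)
      simp [gradientSqrtMul, this]
  have := h (S.indicator f) (hf.indicator hS) (heq ▸ hg) fun ξ hξ => by simp [hξ]
  rw [heq] at this
  exact this.trans (by gcongr; exact eLpNorm_indicator_le _)

end SmoothingBound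

/-! ### Passage to arbitrary data in L² -/

section Limit

open scoped InnerProductSpace
open Filter Topology

variable {E : Type*} [NormedAddCommGroup E] [InnerProductSpace ℝ E] [FiniteDimensional ℝ E]
  [MeasurableSpace E] [BorelSpace E]

theorem integral_mul_fourierInv_eq {f g : E → ℂ} (hf : Integrable f) (hg : Integrable g) :
    ∫ ξ, 𝓕⁻ f ξ * g ξ = ∫ x, f x * 𝓕⁻ g x := by
  have h := VectorFourier.integral_fourierIntegral_smul_eq_flip (L := -innerₗ E)
    (μ := (volume : Measure E)) (ν := (volume : Measure E)) Real.continuous_fourierChar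
    (continuous_inner.neg (f := fun p : E × E => ⟪p.1, p.2⟫_ℝ)) hf hg
  have hflip : (-innerₗ E).flip = -innerₗ E := by
    ext x y; simp [real_inner_comm]
  rw [hflip] at h
  exact h

theorem evolution_eq_fourierInv (β : E → ℝ) (g : E → ℂ) (t : ℝ) (x : E) :
    evolution β g (t, x) = 𝓕⁻ (fun ξ => Real.fourierChar (t * β ξ) • g ξ) x := by
  rw [Real.fourierInv_eq]
  simp only [evolution, AddChar.map_add_eq_mul, mul_smul]

theorem integral_mul_evolution {β : E → ℝ} (hβ : Continuous β) {g : E → ℂ} (hg : Integrable g)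
    (t : ℝ) (ψ : 𝓢(E, ℂ)) :
    ∫ x, ψ x * evolution β g (t, x) = ∫ ξ, 𝓕⁻ ψ ξ * (Real.fourierChar (t * β ξ) • g ξ) := by
  simp_rw [evolution_eq_fourierInv]
  rw [← integral_mul_fourierInv_eq ψ.integrable (integrable_fourierChar_smul (by fun_prop) hg),
    SchwartzMap.fourierInv_coe]

theorem hasTemperateGrowth_ofReal_one_add_norm_sq_rpow (k : ℝ) :
    Function.HasTemperateGrowth fun ξ : E => (((1 + ‖ξ‖ ^ 2) ^ k : ℝ) : ℂ) :=
  Function.HasTemperateGrowth.comp Function.Complex.hasTemperateGrowth_ofReal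
    (Function.hasTemperateGrowth_one_add_norm_sq_rpow E k)

/-- The product of a continuous function of polynomial growth and an `L²` function is a tempered
distribution. -/
theorem exists_temperedDistribution_of_growth {σ : E → ℂ} (hσ : Continuous σ) {C k : ℝ}
    (hσC : ∀ ξ, ‖σ ξ‖ ≤ C * (1 + ‖ξ‖ ^ 2) ^ k) (F : Lp (α := E) ℂ 2 volume) :
    ∃ S : 𝓢'(E, ℂ), ∀ χ : 𝓢(E, ℂ), Integrable (fun ξ => χ ξ * (σ ξ * F ξ)) ∧
      S χ = ∫ ξ, χ ξ * (σ ξ * F ξ) := by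
  set q : E → ℂ := fun ξ => (((1 + ‖ξ‖ ^ 2) ^ k : ℝ) : ℂ) with hq
  have hqg : q.HasTemperateGrowth := hasTemperateGrowth_ofReal_one_add_norm_sq_rpow k
  have hpos : ∀ ξ : E, 0 < ((1 + ‖ξ‖ ^ 2) ^ k : ℝ) := fun ξ => by positivity
  have hq0 : ∀ ξ, q ξ ≠ 0 := fun ξ => Complex.ofReal_ne_zero.mpr (hpos ξ).ne'
  have hqc : Continuous q := hqg.1.continuous
  -- Dividing by the growth `q` leaves a bounded multiple of `F`; `q` is then restored by acting on
  -- test functions.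
  have hG : MemLp (fun ξ => (σ ξ / q ξ) * F ξ) 2 := by
    refine (Lp.memLp F).of_le_mul (c := C)
      ((hσ.div hqc hq0).aestronglyMeasurable.mul (Lp.aestronglyMeasurable F))
      (Eventually.of_forall fun ξ => ?_)
    rw [norm_mul, norm_div, hq, Complex.norm_real, Real.norm_of_nonneg (hpos ξ).le]
    gcongr
    rw [div_le_iff₀ (hpos ξ)]
    exact hσC ξ
  have hval : ∀ (χ : 𝓢(E, ℂ)) ξ, SchwartzMap.smulLeftCLM ℂ q χ ξ * ((σ ξ / q ξ) * F ξ) =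
      χ ξ * (σ ξ * F ξ) := fun χ ξ => by
    rw [SchwartzMap.smulLeftCLM_apply_apply hqg, smul_eq_mul]
    field_simp [hq0 ξ]
  refine ⟨TemperedDistribution.smulLeftCLM ℂ q (hG.toLp _ : 𝓢'(E, ℂ)), fun χ => ⟨?_, ?_⟩⟩
  · have := ((SchwartzMap.smulLeftCLM ℂ q χ).memLp 2).integrable_mul hG
    exact this.congr (Eventually.of_forall (hval χ))
  · rw [TemperedDistribution.smulLeftCLM_apply_apply, Lp.toTemperedDistribution_apply]
    refine integral_congr_ae ?_
    filter_upwards [hG.coeFn_toLp] with ξ hξ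
    rw [hξ, smul_eq_mul, hval]

theorem tendsto_indicator_closedBall_toLp (F : Lp (α := E) ℂ 2 volume) :
    Tendsto (fun k : ℕ => ((Lp.memLp F).indicator (measurableSet_closedBall
      (x := (0 : E)) (ε := (k : ℝ)))).toLp _) atTop (𝓝 F) := by
  rw [Lp.tendsto_Lp_iff_tendsto_eLpNorm']
  have hle : ∀ (k : ℕ) ξ, ‖((Metric.closedBall (0 : E) k).indicator F - F) ξ‖ₑ ≤ ‖F ξ‖ₑ :=
    fun k ξ => by
      by_cases h : ξ ∈ Metric.closedBall (0 : E) k <;> simp [-Metric.mem_closedBall, h]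
  have h : Tendsto (fun k : ℕ =>
      ∫⁻ ξ, ‖((Metric.closedBall (0 : E) k).indicator F - F) ξ‖ₑ ^ 2) atTop (𝓝 0) := by
    have := tendsto_lintegral_of_dominated_convergence' (μ := (volume : Measure E))
      (F := fun (k : ℕ) ξ => ‖((Metric.closedBall (0 : E) k).indicator F - F) ξ‖ₑ ^ 2)
      (f := fun _ => 0) (fun ξ => ‖F ξ‖ₑ ^ 2) (fun k => ?_) (fun k => ?_) ?_ ?_
    · simpa using this
    · exact ((((Lp.aestronglyMeasurable F).indicator measurableSet_closedBall).sub
        (Lp.aestronglyMeasurable F)).enorm.pow_const 2)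
    · exact Eventually.of_forall fun ξ => pow_le_pow_left' (hle k ξ) 2
    · rw [← eLpNorm_two_sq]; exact ENNReal.pow_ne_top (Lp.memLp F).eLpNorm_ne_top
    · refine Eventually.of_forall fun ξ => tendsto_const_nhds.congr' ?_
      filter_upwards [eventually_ge_atTop ⌈‖ξ‖⌉₊] with k hk
      have : ξ ∈ Metric.closedBall (0 : E) k := by
        simpa using (Nat.le_ceil _).trans (Nat.cast_le.mpr hk)
      simp [-Metric.mem_closedBall, this]
  simp_rw [← eLpNorm_two_sq] at h
  have h2 := (ENNReal.continuous_rpow_const (y := (1 / 2 : ℝ))).tendsto 0 |>.comp h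
  rw [ENNReal.zero_rpow_of_pos (by norm_num)] at h2
  refine h2.congr fun k => ?_
  rw [eLpNorm_congr_ae ((MemLp.coeFn_toLp _).sub (EventuallyEq.refl _ _))]
  simp only [Function.comp_apply]
  rw [← ENNReal.rpow_natCast, ← ENNReal.rpow_mul]
  norm_num

theorem integrable_gradientSqrtMul_indicator_closedBall {β : E → ℝ} (hβ : Continuous (gradient β))
    {f : E → ℂ} (hf : MemLp f 2) (r : ℝ) :
    Integrable (gradientSqrtMul β ((Metric.closedBall 0 r).indicator f)) := by
  have h : IntegrableOn (gradientSqrtMul β f) (Metric.closedBall 0 r) := by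
    have hc : Continuous fun ξ => ((‖gradient β ξ‖ ^ (1 / 2 : ℝ) : ℝ) : ℂ) :=
      Complex.continuous_ofReal.comp (hβ.norm.rpow_const fun _ => Or.inr (by norm_num))
    exact ((hf.locallyIntegrable (by norm_num)).integrableOn_isCompact
      (isCompact_closedBall 0 r)).continuousOn_mul hc.continuousOn (isCompact_closedBall 0 r)
  convert! (integrable_indicator_iff measurableSet_closedBall).mpr h using 1
  ext ξ
  by_cases h : ξ ∈ Metric.closedBall (0 : E) r <;>
    simp [gradientSqrtMul, -Metric.mem_closedBall, h]

/-- Convergence in `L²(ℝ × E)` implies, along a subsequence, convergence in `L²(E)` of almost every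
slice. -/
theorem exists_subseq_slices_tendsto {W : ℕ → ℝ × E → ℂ} {V : ℝ × E → ℂ}
    (hW : ∀ k, AEStronglyMeasurable (W k) volume) (hV : AEStronglyMeasurable V volume)
    (h : Tendsto (fun k => eLpNorm (W k - V) 2 volume) atTop (𝓝 0)) :
    ∃ κ : ℕ → ℕ, Tendsto κ atTop atTop ∧
      ∀ᵐ t : ℝ, Tendsto (fun j => eLpNorm (fun x => W (κ j) (t, x) - V (t, x)) 2 volume)
        atTop (𝓝 0) := by
  have h' : Tendsto (fun k => ∫⁻ p, ‖(W k - V) p‖ₑ ^ 2) atTop (𝓝 0) := by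
    simp_rw [← eLpNorm_two_sq]
    simpa using ENNReal.Tendsto.pow (n := 2) h
  have hm : ∀ k, AEMeasurable (fun p => ‖(W k - V) p‖ₑ ^ 2)
      ((volume : Measure ℝ).prod (volume : Measure E)) :=
    fun k => ((hW k).sub hV).enorm.pow_const 2
  -- Squared norms below `2⁻¹ ^ j` are summable, so for almost every `t` the slice norms are
  -- summable as well and tend to zero.
  have hex : ∀ j : ℕ, ∃ k, j ≤ k ∧ ∫⁻ p, ‖(W k - V) p‖ₑ ^ 2 < 2⁻¹ ^ j := fun j => by
    have hpos : (0 : ℝ≥0∞) < 2⁻¹ ^ j := ENNReal.pow_pos (by simp) j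
    exact ((eventually_ge_atTop j).and (h'.eventually_lt_const hpos)).exists
  choose κ hκ hκlt using hex
  refine ⟨κ, tendsto_atTop_mono hκ tendsto_id, ?_⟩
  have hsum : ∫⁻ t : ℝ, ∑' j, ∫⁻ x : E, ‖(W (κ j) - V) (t, x)‖ₑ ^ 2 ≠ ⊤ := by
    rw [lintegral_tsum fun j => (hm _).lintegral_prod_right']
    refine ne_top_of_le_ne_top ?_ (ENNReal.tsum_le_tsum fun j => ?_) (b := ∑' j : ℕ, 2⁻¹ ^ j)
    · rw [ENNReal.tsum_geometric]; simp
    · rw [← lintegral_prod _ (hm _), ← Measure.volume_eq_prod]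
      exact (hκlt j).le
  filter_upwards [ae_lt_top' (AEMeasurable.tsum fun j => (hm _).lintegral_prod_right') hsum]
    with t ht
  have := ENNReal.tendsto_atTop_zero_of_tsum_ne_top ht.ne
  have h2 := (ENNReal.continuous_rpow_const (y := (1 / 2 : ℝ))).tendsto 0 |>.comp this
  rw [ENNReal.zero_rpow_of_pos (by norm_num)] at h2
  refine h2.congr fun k => ?_
  simp only [Function.comp_apply, Pi.sub_apply]
  rw [← eLpNorm_two_sq, ← ENNReal.rpow_natCast, ← ENNReal.rpow_mul]
  norm_num

/-- Truncation to frequency balls makes `|∇β|^{1/2} F` integrable, and by linearity the bound makes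
the weighted evolutions Cauchy. Their limit, with the weight divided out, is `v`. It is identified
by pairing with `ψ`: slices converge along a subsequence for almost every `t`, and the frequency
side converges by dominated convergence. The null set of times is fixed before `ψ`. -/
theorem exists_evolution_limit {β : E → ℝ} {s : ℝ} (hβ : Continuous β)
    (hgrad : Continuous (gradient β)) {A k : ℝ}
    (hA : ∀ ξ, ‖gradient β ξ‖ ^ (1 / 2 : ℝ) ≤ A * (1 + ‖ξ‖ ^ 2) ^ k)
    {C : ℝ≥0} (hC : ∀ f : E → ℂ, MemLp f 2 → Integrable (gradientSqrtMul β f) →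
      eLpNorm (fun p : ℝ × E => (((1 + ‖p.2‖ ^ 2) ^ (-s / 2) : ℝ) : ℂ) *
        evolution β (gradientSqrtMul β f) p) 2 volume ≤ C * eLpNorm f 2 volume)
    (F : Lp (α := E) ℂ 2 volume) :
    ∃ v : ℝ × E → ℂ, StronglyMeasurable v ∧
      eLpNorm (fun p : ℝ × E => (((1 + ‖p.2‖ ^ 2) ^ (-s / 2) : ℝ) : ℂ) * v p) 2 volume ≤
        C * ‖F‖ₑ ∧
      ∀ᵐ t : ℝ, ∀ ψ : 𝓢(E, ℂ), Integrable (fun x => ψ x * v (t, x)) ∧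
        ∫ x, ψ x * v (t, x) =
          ∫ ξ, 𝓕⁻ ψ ξ * (Real.fourierChar (t * β ξ) • gradientSqrtMul β F ξ) := by
  set w : E → ℂ := fun x => (((1 + ‖x‖ ^ 2) ^ (-s / 2) : ℝ) : ℂ) with hw
  set w' : E → ℂ := fun x => (((1 + ‖x‖ ^ 2) ^ (s / 2) : ℝ) : ℂ) with hw'
  have hw'g : w'.HasTemperateGrowth := hasTemperateGrowth_ofReal_one_add_norm_sq_rpow _
  have hww' : ∀ x, w' x * w x = 1 := fun x => by
    rw [hw, hw', ← Complex.ofReal_mul, ← Real.rpow_add (by positivity)]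
    simp [neg_div]
  set f : ℕ → E → ℂ := fun k => (Metric.closedBall (0 : E) k).indicator F with hf
  have hfmem : ∀ k, MemLp (f k) 2 := fun k => (Lp.memLp F).indicator measurableSet_closedBall
  have hfint : ∀ k, Integrable (gradientSqrtMul β (f k)) := fun k =>
    integrable_gradientSqrtMul_indicator_closedBall hgrad (Lp.memLp F) k
  have hflim : Tendsto (fun k => (hfmem k).toLp (f k)) atTop (𝓝 F) :=
    tendsto_indicator_closedBall_toLp F
  set W : ℕ → ℝ × E → ℂ := fun k p => w p.2 * evolution β (gradientSqrtMul β (f k)) p with hWdef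
  have hWm : ∀ k, AEStronglyMeasurable (W k) volume := fun k =>
    aestronglyMeasurable_weight_mul (continuous_evolution hβ (hfint k))
  have hWle : ∀ k, eLpNorm (W k) 2 volume ≤ C * eLpNorm (f k) 2 volume := fun k =>
    hC _ (hfmem k) (hfint k)
  have hWmem : ∀ k, MemLp (W k) 2 := fun k => ⟨hWm k,
    (hWle k).trans_lt (ENNReal.mul_lt_top ENNReal.coe_lt_top (hfmem k).eLpNorm_lt_top)⟩
  have hWsub : ∀ k l, eLpNorm (W k - W l) 2 volume ≤ C * eLpNorm (f k - f l) 2 volume := by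
    intro k l
    have h₁ : gradientSqrtMul β (f k - f l) =
        fun ξ => gradientSqrtMul β (f k) ξ - gradientSqrtMul β (f l) ξ := by
      ext ξ; simp [gradientSqrtMul, mul_sub]
    have h₂ : W k - W l = fun p => w p.2 * evolution β (gradientSqrtMul β (f k - f l)) p := by
      ext p
      rw [h₁, evolution_sub hβ (hfint k) (hfint l), mul_sub]
      rfl
    rw [h₂]
    exact hC _ ((hfmem k).sub (hfmem l)) (h₁ ▸ (hfint k).sub (hfint l))
  have hdist : ∀ k l, dist ((hWmem k).toLp (W k)) ((hWmem l).toLp (W l)) ≤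
      C * dist ((hfmem k).toLp (f k)) ((hfmem l).toLp (f l)) := by
    intro k l
    rw [dist_eq_norm, dist_eq_norm, ← MemLp.toLp_sub, ← MemLp.toLp_sub, Lp.norm_toLp,
      Lp.norm_toLp, ← ENNReal.coe_toReal, ← ENNReal.toReal_mul]
    exact ENNReal.toReal_mono (ENNReal.mul_ne_top ENNReal.coe_ne_top
      ((hfmem k).sub (hfmem l)).eLpNorm_ne_top) (hWsub k l)
  have hcauchy : CauchySeq fun k => (hWmem k).toLp (W k) := by
    rw [cauchySeq_iff_tendsto_dist_atTop_0]
    have := (cauchySeq_iff_tendsto_dist_atTop_0.mp hflim.cauchySeq).const_mul (C : ℝ)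
    rw [mul_zero] at this
    exact squeeze_zero (fun _ => dist_nonneg) (fun p => hdist p.1 p.2) this
  obtain ⟨V, hV⟩ := cauchySeq_tendsto_of_complete hcauchy
  have hVnorm : ‖V‖ ≤ C * ‖F‖ := by
    refine le_of_tendsto_of_tendsto' hV.norm (hflim.norm.const_mul (C : ℝ)) fun k => ?_
    rw [Lp.norm_toLp, Lp.norm_toLp, ← ENNReal.coe_toReal, ← ENNReal.toReal_mul]
    exact ENNReal.toReal_mono (ENNReal.mul_ne_top ENNReal.coe_ne_top
      (hfmem k).eLpNorm_ne_top) (hWle k)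
  have hVm : StronglyMeasurable (V : ℝ × E → ℂ) := Lp.stronglyMeasurable V
  have hV' : Tendsto (fun k => eLpNorm (W k - (V : ℝ × E → ℂ)) 2 volume) atTop
      (𝓝 0) := by
    rw [Lp.tendsto_Lp_iff_tendsto_eLpNorm'] at hV
    refine hV.congr fun k => ?_
    exact eLpNorm_congr_ae ((hWmem k).coeFn_toLp.sub (EventuallyEq.refl _ _))
  have hVslice : ∀ᵐ t : ℝ, MemLp (fun x => V (t, x)) 2 (volume : Measure E) := by
    have hfin : ∫⁻ t : ℝ, ∫⁻ x : E, ‖V (t, x)‖ₑ ^ 2 ≠ ⊤ := by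
      rw [← lintegral_prod (fun p : ℝ × E => ‖V p‖ₑ ^ 2) (hVm.enorm.pow_const 2).aemeasurable,
        ← Measure.volume_eq_prod, ← eLpNorm_two_sq]
      exact ENNReal.pow_ne_top (Lp.memLp V).eLpNorm_ne_top
    filter_upwards [ae_lt_top (hVm.enorm.pow_const 2).lintegral_prod_right' hfin] with t ht
    refine ⟨(hVm.comp_measurable measurable_prodMk_left).aestronglyMeasurable, ?_⟩
    rw [← eLpNorm_two_sq] at ht
    exact (ENNReal.pow_lt_top_iff.mp ht).resolve_right two_ne_zero
  obtain ⟨κ, hκ, hslices⟩ := exists_subseq_slices_tendsto hWm hVm.aestronglyMeasurable hV'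
  have hw'c : Continuous fun p : ℝ × E => w' p.2 := hw'g.1.continuous.comp continuous_snd
  refine ⟨fun p => w' p.2 * V p, hw'c.stronglyMeasurable.mul hVm, ?_, ?_⟩
  · have : (fun p : ℝ × E => w p.2 * (w' p.2 * V p)) = V := by
      ext p; rw [← mul_assoc, mul_comm (w p.2), hww', one_mul]
    change eLpNorm (fun p : ℝ × E => w p.2 * (w' p.2 * V p)) 2 volume ≤ _
    rw [this, ← Lp.enorm_def, ← ofReal_norm, ← ofReal_norm, ← ENNReal.ofReal_coe_nnreal,
      ← ENNReal.ofReal_mul C.coe_nonneg]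
    exact ENNReal.ofReal_le_ofReal hVnorm
  filter_upwards [hVslice, hslices] with t hVt hlim ψ
  -- The inverse weight has temperate growth, so it can be moved onto the test function, leaving an
  -- `L²` pairing with the slice of `V`.
  set θ : 𝓢(E, ℂ) := SchwartzMap.smulLeftCLM ℂ w' ψ with hθ
  have hθapp : ∀ x, θ x = w' x * ψ x := fun x => by
    rw [hθ, SchwartzMap.smulLeftCLM_apply_apply hw'g, smul_eq_mul]
  have hmem : MemLp θ 2 := θ.memLp 2
  have hlimint : Integrable fun x => θ x * V (t, x) := hmem.integrable_mul hVt
  have heq : (fun x => ψ x * (w' x * V (t, x))) = fun x => θ x * V (t, x) := by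
    ext x; rw [hθapp]; ring
  refine ⟨heq ▸ hlimint, ?_⟩
  change ∫ x, (fun x => ψ x * (w' x * V (t, x))) x = _
  rw [heq]
  have hDm : ∀ j, AEStronglyMeasurable (fun x => W (κ j) (t, x) - V (t, x)) volume := fun j => by
    refine AEStronglyMeasurable.sub ?_ hVt.aestronglyMeasurable
    have : Continuous fun x => W (κ j) (t, x) := by
      have h₁ : Continuous w := (hasTemperateGrowth_ofReal_one_add_norm_sq_rpow _).1.continuous
      exact h₁.mul ((continuous_evolution hβ (hfint _)).comp (by fun_prop))
    exact this.aestronglyMeasurable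
  have hleft : Tendsto (fun j => ∫ x, θ x * W (κ j) (t, x)) atTop
      (𝓝 (∫ x, θ x * V (t, x))) := by
    refine tendsto_integral_of_L1' _ hlimint.aestronglyMeasurable ?_ ?_
    · filter_upwards [hlim.eventually_lt_const zero_lt_one] with j hj
      have hD : MemLp (fun x => W (κ j) (t, x) - V (t, x)) 2 :=
        ⟨hDm j, hj.trans ENNReal.one_lt_top⟩
      have := hD.add hVt
      refine hmem.integrable_mul (q := 2) ?_
      convert! this using 1
      ext x; simp
    · have h0 := ENNReal.Tendsto.const_mul (a := eLpNorm θ 2 volume) hlim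
        (Or.inr hmem.eLpNorm_ne_top)
      rw [mul_zero] at h0
      refine tendsto_of_tendsto_of_tendsto_of_le_of_le tendsto_const_nhds h0
        (fun _ => zero_le) fun j => ?_
      have := eLpNorm_smul_le_mul_eLpNorm (p := 2) (q := 2) (r := 1) (hDm j)
        hmem.aestronglyMeasurable
      refine le_trans (le_of_eq ?_) this
      congr 1
      ext x
      simp [mul_sub]
  have hright : Tendsto (fun j => ∫ x, θ x * W (κ j) (t, x)) atTop
      (𝓝 (∫ ξ, 𝓕⁻ ψ ξ * (Real.fourierChar (t * β ξ) • gradientSqrtMul β F ξ))) := by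
    have hpair : ∀ j, ∫ x, θ x * W (κ j) (t, x) =
        ∫ ξ, 𝓕⁻ ψ ξ * (Real.fourierChar (t * β ξ) • gradientSqrtMul β (f (κ j)) ξ) := fun j => by
      rw [← integral_mul_evolution hβ (hfint _)]
      congr 1 with x
      rw [hθapp, hWdef]
      linear_combination (ψ x * evolution β (gradientSqrtMul β (f (κ j))) (t, x)) * hww' x
    simp_rw [hpair]
    have hc : Continuous fun ξ => ((‖gradient β ξ‖ ^ (1 / 2 : ℝ) : ℝ) : ℂ) :=
      Complex.continuous_ofReal.comp (hgrad.norm.rpow_const fun _ => Or.inr (by norm_num))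
    obtain ⟨S, hS⟩ := exists_temperedDistribution_of_growth hc (fun ξ => by
      rw [Complex.norm_real, Real.norm_of_nonneg (by positivity)]; exact hA ξ) F
    refine tendsto_integral_of_dominated_convergence
      (fun ξ => ‖𝓕⁻ ψ ξ * gradientSqrtMul β F ξ‖) (fun j => ?_) (hS (𝓕⁻ ψ)).1.norm
      (fun j => ?_) ?_
    · exact (𝓕⁻ ψ).continuous.aestronglyMeasurable.mul
        (integrable_fourierChar_smul (by fun_prop) (hfint _)).aestronglyMeasurable
    · refine Eventually.of_forall fun ξ => ?_
      rw [norm_mul, norm_mul, Circle.norm_smul]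
      gcongr
      simp only [gradientSqrtMul, norm_mul, hf]
      gcongr
      exact norm_indicator_le_norm_self _ _
    · refine Eventually.of_forall fun ξ => tendsto_const_nhds.congr' ?_
      filter_upwards [hκ.eventually (eventually_ge_atTop ⌈‖ξ‖⌉₊)] with j hj
      have : ξ ∈ Metric.closedBall (0 : E) (κ j) := by
        simpa using (Nat.le_ceil _).trans (Nat.cast_le.mpr hj)
      simp only [gradientSqrtMul, hf, Set.indicator_of_mem this]
  exact tendsto_nhds_unique hleft hright

end Limit

/-! ### Finite transversal covers, locally and at infinity -/

section Cover

open scoped InnerProductSpace Pointwise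
open Filter Topology

variable {E : Type*} [NormedAddCommGroup E] [InnerProductSpace ℝ E] [FiniteDimensional ℝ E]
  [MeasurableSpace E] [BorelSpace E]

theorem fderiv_apply_eq_inner_gradient {a : E → ℝ} (ξ e : E) :
    fderiv ℝ a ξ e = ⟪e, gradient a ξ⟫_ℝ := by
  rw [real_inner_comm, gradient, InnerProductSpace.toDual_symm_apply]

theorem hasDerivAt_comp_line {a : E → ℝ} (ha : Differentiable ℝ a) (ξ e : E) (t : ℝ) :
    HasDerivAt (fun t : ℝ => a (ξ + t • e)) ⟪e, gradient a (ξ + t • e)⟫_ℝ t := by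
  rw [← fderiv_apply_eq_inner_gradient]
  have h : HasDerivAt (fun t : ℝ => ξ + t • e) e t := by
    simpa using ((hasDerivAt_id t).smul_const e).const_add ξ
  exact (ha _).hasFDerivAt.comp_hasDerivAt t h

theorem Convex.add_smul_mem_of_mem_Ioo {K : Set E} (hK : Convex ℝ K) {ξ e : E} {t τ : ℝ}
    (hξ : ξ ∈ K) (ht : ξ + t • e ∈ K) (hτ : τ ∈ Set.Ioo 0 t) : ξ + τ • e ∈ K := by
  have h0 : 0 < t := hτ.1.trans hτ.2
  have := hK.add_smul_mem hξ ht (t := τ / t)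
    ⟨div_nonneg hτ.1.le h0.le, (div_le_one h0).mpr hτ.2.le⟩
  rwa [smul_smul, div_mul_cancel₀ _ h0.ne'] at this

/-- The derivative along `e` is positive on `K`, and by convexity the segment between two points of
`K` stays in `K`; equal values would contradict Rolle's theorem. -/
theorem transversalOn_of_convex {a : E → ℝ} (ha : Differentiable ℝ a) {K : Set E}
    (hK : Convex ℝ K) (hKm : MeasurableSet K) {e : E} (he : ‖e‖ = 1) {c : ℝ} (hc : 0 < c)
    (h : ∀ ξ ∈ K, c * ‖gradient a ξ‖ < ⟪e, gradient a ξ⟫_ℝ) : TransversalOn a e c K := by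
  have hpos : ∀ ξ ∈ K, 0 < ⟪e, gradient a ξ⟫_ℝ := fun ξ hξ =>
    (mul_nonneg hc.le (norm_nonneg _)).trans_lt (h ξ hξ)
  refine ⟨hKm, he, hc, fun ξ hξ h0 => ?_, fun ξ hξ => ?_, fun ξ hξ t ht hξt heq => ?_⟩
  · have := hpos ξ hξ
    simp [h0] at this
  · exact (h ξ hξ).le.trans (le_abs_self _)
  · obtain ⟨τ, hτ, h0⟩ := exists_hasDerivAt_eq_zero (f := fun t : ℝ => a (ξ + t • e)) ht
      (fun τ _ => (hasDerivAt_comp_line ha ξ e τ).continuousAt.continuousWithinAt)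
      (by simpa using heq.symm) fun τ _ => hasDerivAt_comp_line ha ξ e τ
    exact (hpos _ (hK.add_smul_mem_of_mem_Ioo hξ hξt hτ)).ne' h0

theorem continuous_gradient {a : E → ℝ} (ha : ContDiff ℝ 1 a) : Continuous (gradient a) :=
  (InnerProductSpace.toDual ℝ E).symm.continuous.comp (ha.continuous_fderiv one_ne_zero)

/-- Where the second derivative along `e` does not change sign, the derivative along `e` is
monotone along lines, hence the set where it is positive meets each of them in an interval. -/
theorem transversalOn_of_sndDeriv_ne_zero {a : E → ℝ} (ha : ContDiff ℝ 2 a) {K : Set E}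
    (hK : Convex ℝ K) (hKm : MeasurableSet K) {e : E} (he : ‖e‖ = 1) {c : ℝ} (hc : 0 < c) {κ : ℝ}
    (h : ∀ ξ ∈ K, 0 < κ * fderiv ℝ (fderiv ℝ a) ξ e e) :
    TransversalOn a e c
      {ξ ∈ K | gradient a ξ ≠ 0 ∧ c * ‖gradient a ξ‖ ≤ ⟪e, gradient a ξ⟫_ℝ} := by
  have hg : Continuous (gradient a) := continuous_gradient (ha.of_le one_le_two)
  have hd : Differentiable ℝ a := ha.differentiable two_ne_zero
  have hd₂ : Differentiable ℝ (fderiv ℝ a) :=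
    (ha.fderiv_right (m := 1) (by norm_num)).differentiable one_ne_zero
  have hline : ∀ (ξ : E) (t : ℝ), HasDerivAt (fun t : ℝ => ⟪e, gradient a (ξ + t • e)⟫_ℝ)
      (fderiv ℝ (fderiv ℝ a) (ξ + t • e) e e) t := by
    intro ξ t
    simp_rw [← fderiv_apply_eq_inner_gradient]
    have h : HasDerivAt (fun t : ℝ => ξ + t • e) e t := by
      simpa using ((hasDerivAt_id t).smul_const e).const_add ξ
    have h' := (hd₂ _).hasFDerivAt.comp_hasDerivAt t h
    simpa using h'.clm_apply (hasDerivAt_const t e)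
  refine ⟨hKm.inter (MeasurableSet.inter ?_ ?_), he, hc, fun ξ hξ => hξ.2.1,
    fun ξ hξ => hξ.2.2.trans (le_abs_self _), fun ξ hξ t ht hξt heq => ?_⟩
  · exact (isOpen_ne_fun hg continuous_const).measurableSet
  · have h₁ : Continuous fun ξ => c * ‖gradient a ξ‖ := by fun_prop
    have h₂ : Continuous fun ξ => ⟪e, gradient a ξ⟫_ℝ := by fun_prop
    exact (isClosed_le h₁ h₂).measurableSet
  · have hpos : ∀ ξ, gradient a ξ ≠ 0 ∧ c * ‖gradient a ξ‖ ≤ ⟪e, gradient a ξ⟫_ℝ →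
        0 < ⟪e, gradient a ξ⟫_ℝ := fun ξ hξ =>
      (mul_pos hc (norm_pos_iff.mpr hξ.1)).trans_le hξ.2
    obtain ⟨τ, hτ, h0⟩ := exists_hasDerivAt_eq_zero (f := fun t : ℝ => a (ξ + t • e)) ht
      (fun τ _ => (hasDerivAt_comp_line hd ξ e τ).continuousAt.continuousWithinAt)
      (by simpa using heq.symm) fun τ _ => hasDerivAt_comp_line hd ξ e τ
    obtain ⟨t₁, ht₁, h₁⟩ := exists_hasDerivAt_eq_slope
      (fun t : ℝ => ⟪e, gradient a (ξ + t • e)⟫_ℝ) _ hτ.1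
      (fun x _ => (hline ξ x).continuousAt.continuousWithinAt) fun x _ => hline ξ x
    obtain ⟨t₂, ht₂, h₂⟩ := exists_hasDerivAt_eq_slope
      (fun t : ℝ => ⟪e, gradient a (ξ + t • e)⟫_ℝ) _ hτ.2
      (fun x _ => (hline ξ x).continuousAt.continuousWithinAt) fun x _ => hline ξ x
    have k₁ := h _ (hK.add_smul_mem_of_mem_Ioo hξ.1 hξt.1 ⟨ht₁.1, ht₁.2.trans hτ.2⟩)
    have k₂ := h _ (hK.add_smul_mem_of_mem_Ioo hξ.1 hξt.1 ⟨hτ.1.trans ht₂.1, ht₂.2⟩)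
    -- The derivative along the line is positive at both ends and zero at `τ`. Its mean slopes on
    -- the two sides of `τ` have opposite signs, which the fixed sign of the second derivative
    -- forbids.
    have p₀ := hpos _ hξ.2
    have p₁ := hpos _ hξt.2
    have n₁ : fderiv ℝ (fderiv ℝ a) (ξ + t₁ • e) e e < 0 := by
      rw [h₁, h0]
      refine div_neg_of_neg_of_pos ?_ (sub_pos.mpr hτ.1)
      simpa using p₀
    have n₂ : 0 < fderiv ℝ (fderiv ℝ a) (ξ + t₂ • e) e e := by
      rw [h₂, h0]
      exact div_pos (by simpa using p₁) (sub_pos.mpr hτ.2)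
    have κneg : κ < 0 := by
      by_contra! hκ
      exact absurd k₁ (not_lt.mpr (mul_nonpos_of_nonneg_of_nonpos hκ n₁.le))
    exact absurd k₂ (not_lt.mpr (mul_nonpos_of_nonpos_of_nonneg κneg.le n₂.le))

/-- Up to critical points of `a`, the set `S` is covered by finitely many transversal sets. -/
def HasTransversalCover (a : E → ℝ) (S : Set E) : Prop :=
  ∃ T : Set (Set E), T.Finite ∧ (∀ Ω ∈ T, ∃ e c, TransversalOn a e c Ω) ∧
    {ξ ∈ S | gradient a ξ ≠ 0} ⊆ ⋃₀ T

theorem HasTransversalCover.mono {a : E → ℝ} {S S' : Set E} (h : HasTransversalCover a S')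
    (hS : S ⊆ S') : HasTransversalCover a S := by
  obtain ⟨T, hT, hΩ, hsub⟩ := h
  exact ⟨T, hT, hΩ, fun ξ hξ => hsub ⟨hS hξ.1, hξ.2⟩⟩

theorem HasTransversalCover.union {a : E → ℝ} {S S' : Set E} (h : HasTransversalCover a S)
    (h' : HasTransversalCover a S') : HasTransversalCover a (S ∪ S') := by
  obtain ⟨T, hT, hΩ, hsub⟩ := h
  obtain ⟨T', hT', hΩ', hsub'⟩ := h'
  refine ⟨T ∪ T', hT.union hT', fun Ω h => h.elim (hΩ Ω) (hΩ' Ω), ?_⟩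
  rw [Set.sUnion_union]
  rintro ξ ⟨h | h, hξ⟩
  · exact Or.inl (hsub ⟨h, hξ⟩)
  · exact Or.inr (hsub' ⟨h, hξ⟩)

theorem hasTransversalCover_empty (a : E → ℝ) : HasTransversalCover a ∅ :=
  ⟨∅, Set.finite_empty, by simp, by simp⟩

theorem TransversalOn.hasTransversalCover {a : E → ℝ} {e : E} {c : ℝ} {Ω : Set E}
    (h : TransversalOn a e c Ω) : HasTransversalCover a Ω :=
  ⟨{Ω}, Set.finite_singleton _, by rintro _ rfl; exact ⟨e, c, h⟩, fun ξ hξ => by simpa using hξ.1⟩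

theorem half_norm_lt_inner_normalize {v : E} (hv : v ≠ 0) :
    1 / 2 * ‖v‖ < ⟪‖v‖⁻¹ • v, v⟫_ℝ := by
  have h : 0 < ‖v‖ := norm_pos_iff.mpr hv
  rw [inner_smul_left, real_inner_self_eq_norm_sq]
  have : (starRingEnd ℝ) ‖v‖⁻¹ * ‖v‖ ^ 2 = ‖v‖ := by simp; field_simp
  rw [this]; linarith

theorem exists_hasTransversalCover_of_gradient_ne_zero {a : E → ℝ} (ha : ContDiff ℝ 1 a) {ξ₀ : E}
    (h : gradient a ξ₀ ≠ 0) : ∃ S ∈ 𝓝 ξ₀, HasTransversalCover a S := by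
  have hg := continuous_gradient ha
  set e := ‖gradient a ξ₀‖⁻¹ • gradient a ξ₀
  have hopen : IsOpen {ξ | 1 / 2 * ‖gradient a ξ‖ < ⟪e, gradient a ξ⟫_ℝ} :=
    isOpen_lt (by fun_prop) (by fun_prop)
  obtain ⟨ε, hε, hball⟩ := Metric.isOpen_iff.mp hopen ξ₀ (half_norm_lt_inner_normalize h)
  exact ⟨_, Metric.ball_mem_nhds ξ₀ hε, (transversalOn_of_convex (ha.differentiable one_ne_zero)
    (convex_ball ξ₀ ε) measurableSet_ball (norm_smul_inv_norm h) (by norm_num : (0 : ℝ) < 1 / 2)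
    fun ξ hξ => hball hξ).hasTransversalCover⟩

/-- Polarization: a symmetric form is determined by its quadratic form. -/
theorem exists_apply_self_ne_zero {B : E →L[ℝ] E →L[ℝ] ℝ} (hsymm : ∀ u v, B u v = B v u)
    (hB : B ≠ 0) : ∃ e, B e e ≠ 0 := by
  by_contra! h
  refine hB (ContinuousLinearMap.ext fun u => ContinuousLinearMap.ext fun v => ?_)
  have := h (u + v)
  simp only [map_add, add_apply, h, hsymm v u] at this
  simp only [zero_apply]
  linarith

/-- The vectors on which a nonzero quadratic form does not vanish contain a basis. -/
theorem exists_unit_family_apply_self_ne_zero {B : E →L[ℝ] E →L[ℝ] ℝ}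
    (hsymm : ∀ u v, B u v = B v u) (hB : B ≠ 0) :
    ∃ (ι : Type) (_ : Finite ι) (d : ι → E) (c : ℝ), 0 < c ∧ (∀ i, ‖d i‖ = 1) ∧
      (∀ i, B (d i) (d i) ≠ 0) ∧ ∀ v, v ≠ 0 → ∃ i, c * ‖v‖ ≤ |⟪d i, v⟫_ℝ| := by
  set U : Set E := {e | B e e ≠ 0}
  have hUo : IsOpen U := isOpen_ne_fun (by fun_prop) continuous_const
  -- `U` is open and nonempty, so its span has interior points and is everything.
  have hspan : ⊤ ≤ Submodule.span ℝ U := by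
    refine (Submodule.eq_top_of_nonempty_interior' _ ?_).ge
    obtain ⟨e, he⟩ := exists_apply_self_ne_zero hsymm hB
    exact ⟨e, interior_mono Submodule.subset_span (hUo.interior_eq.symm ▸ he)⟩
  set b₀ := Module.Basis.ofSpan hspan
  have hb₀ : ∀ i, b₀ i ∈ U := fun i => Module.Basis.ofSpan_subset hspan ⟨i, rfl⟩
  have hfin : Finite _ := Module.Finite.finite_basis b₀
  set b : Module.Basis (Fin (Nat.card _)) ℝ E := b₀.reindex (Finite.equivFin _) with hb
  have hbU : ∀ i, B (b i) (b i) ≠ 0 := fun i => by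
    rw [hb, Module.Basis.reindex_apply]; exact hb₀ _
  set d : Fin _ → E := fun i => ‖b i‖⁻¹ • b i with hd
  have hn : ∀ i, 0 < ‖b i‖ := fun i => norm_pos_iff.mpr (b.ne_zero i)
  -- Pairing with a basis is injective, hence bounded below with constant `K⁻¹`. In the sup norm
  -- this says that a single coordinate is large.
  set L : E →ₗ[ℝ] (Fin _ → ℝ) := LinearMap.pi fun i => innerₗ E (d i) with hL
  have hLapp : ∀ v i, L v i = ⟪d i, v⟫_ℝ := fun v i => rfl
  have hker : L.ker = ⊥ := by
    rw [LinearMap.ker_eq_bot']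
    intro v hv
    have hz : innerₗ E v = 0 := b.ext fun i => by
      have := congrFun hv i
      rw [hLapp, hd, inner_smul_left, real_inner_comm] at this
      exact (mul_eq_zero.mp this).resolve_left (by simpa using b.ne_zero i)
    exact inner_self_eq_zero.mp (DFunLike.congr_fun hz v)
  obtain ⟨K, hK, hanti⟩ := L.exists_antilipschitzWith hker
  refine ⟨_, inferInstance, d, (K : ℝ)⁻¹ , by positivity, fun i => ?_, fun i => ?_, fun v hv => ?_⟩
  · exact norm_smul_inv_norm (b.ne_zero i)
  · simp only [hd, map_smul, smul_apply, smul_eq_mul]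
    have := (hn i).ne'
    have := hbU i
    positivity
  · have hle : ‖v‖ ≤ K * ‖L v‖ := by
      have := hanti.le_mul_dist v 0
      rwa [map_zero, dist_zero_right, dist_zero_right] at this
    have hLv : 0 < ‖L v‖ := by
      by_contra! h0
      have : ‖L v‖ = 0 := le_antisymm h0 (norm_nonneg _)
      rw [this, mul_zero] at hle
      exact hv (norm_le_zero_iff.mp hle)
    by_contra! hlt
    have : ‖L v‖ < (K : ℝ)⁻¹ * ‖v‖ := by
      rw [pi_norm_lt_iff (by have := norm_pos_iff.mpr hv; positivity)]
      exact hlt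
    rw [inv_mul_eq_div, lt_div_iff₀ (by positivity)] at this
    linarith

theorem exists_hasTransversalCover_of_sndDeriv_ne_zero {a : E → ℝ} (ha : ContDiff ℝ 2 a) {ξ₀ : E}
    (h : fderiv ℝ (fderiv ℝ a) ξ₀ ≠ 0) : ∃ S ∈ 𝓝 ξ₀, HasTransversalCover a S := by
  have hsymm : ∀ u v, fderiv ℝ (fderiv ℝ a) ξ₀ u v = fderiv ℝ (fderiv ℝ a) ξ₀ v u :=
    (ha.contDiffAt.isSymmSndFDerivAt (by simp)).eq
  have hcont : Continuous (fderiv ℝ (fderiv ℝ a)) :=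
    (ha.fderiv_right (m := 1) (by norm_num)).continuous_fderiv one_ne_zero
  obtain ⟨ι, _, d, c, hc, hd, hne, hcov⟩ := exists_unit_family_apply_self_ne_zero hsymm h
  set κ : ι → ℝ := fun i => fderiv ℝ (fderiv ℝ a) ξ₀ (d i) (d i)
  have hev : ∀ᶠ ξ in 𝓝 ξ₀, ∀ i, 0 < κ i * fderiv ℝ (fderiv ℝ a) ξ (d i) (d i) := by
    rw [eventually_all]
    intro i
    have hci : Continuous fun ξ => κ i * fderiv ℝ (fderiv ℝ a) ξ (d i) (d i) := by fun_prop
    exact hci.continuousAt.eventually_const_lt (mul_self_pos.mpr (hne i))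
  obtain ⟨ε, hε, hball⟩ := Metric.eventually_nhds_iff_ball.mp hev
  -- Both signs of each direction are needed: a large `|⟪d i, v⟫|` is a large inner product with `d
  -- i` or with `-d i`, and the second derivative is the same for both.
  refine ⟨_, Metric.ball_mem_nhds ξ₀ hε,
    Set.range (fun i => {ξ ∈ Metric.ball ξ₀ ε | gradient a ξ ≠ 0 ∧
      c * ‖gradient a ξ‖ ≤ ⟪d i, gradient a ξ⟫_ℝ}) ∪
    Set.range (fun i => {ξ ∈ Metric.ball ξ₀ ε | gradient a ξ ≠ 0 ∧
      c * ‖gradient a ξ‖ ≤ ⟪-d i, gradient a ξ⟫_ℝ}),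
    (Set.finite_range _).union (Set.finite_range _), ?_, ?_⟩
  · rintro Ω (⟨i, rfl⟩ | ⟨i, rfl⟩)
    · exact ⟨_, _, transversalOn_of_sndDeriv_ne_zero ha (convex_ball ξ₀ ε) measurableSet_ball
        (hd i) hc fun ξ hξ => hball ξ hξ i⟩
    · refine ⟨_, _, transversalOn_of_sndDeriv_ne_zero ha (convex_ball ξ₀ ε) measurableSet_ball
        (by rw [norm_neg, hd i]) hc (κ := κ i) fun ξ hξ => ?_⟩
      simpa using hball ξ hξ i
  · rintro ξ ⟨hξ, h0⟩
    obtain ⟨i, hi⟩ := hcov _ h0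
    rcases le_abs'.mp hi with h₁ | h₁
    · refine Set.mem_sUnion.mpr ⟨_, Or.inr ⟨i, rfl⟩, hξ, h0, ?_⟩
      rw [inner_neg_left]; linarith
    · exact Set.mem_sUnion.mpr ⟨_, Or.inl ⟨i, rfl⟩, hξ, h0, h₁⟩

theorem hasTransversalCover_of_isCompact {a : E → ℝ} (ha : ContDiff ℝ 2 a)
    (hcrit : ∀ ξ, gradient a ξ = 0 → fderiv ℝ (fderiv ℝ a) ξ ≠ 0) {S : Set E} (hS : IsCompact S) :
    HasTransversalCover a S := by
  refine hS.induction_on (hasTransversalCover_empty a) (fun _ _ h₁ h₂ => h₂.mono h₁)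
    (fun _ _ h₁ h₂ => h₁.union h₂) fun ξ _ => ?_
  obtain ⟨t, ht, h⟩ : ∃ t ∈ 𝓝 ξ, HasTransversalCover a t := by
    by_cases h0 : gradient a ξ = 0
    · exact exists_hasTransversalCover_of_sndDeriv_ne_zero ha (hcrit ξ h0)
    · exact exists_hasTransversalCover_of_gradient_ne_zero (ha.of_le one_le_two) h0
  exact ⟨t, mem_nhdsWithin_of_mem_nhds ht, h⟩

/-- The part outside of the ball of radius `r` of the cone over `S`, if `S` is in the unit
sphere. -/
def truncatedCone (r : ℝ) (S : Set E) : Set E := ⋃ l ∈ Set.Ioi r, l • S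

theorem mem_truncatedCone {r : ℝ} {S : Set E} {ξ : E} :
    ξ ∈ truncatedCone r S ↔ ∃ l, r < l ∧ ∃ θ ∈ S, l • θ = ξ := by
  simp [truncatedCone, Set.mem_smul_set]

theorem truncatedCone_mono {r r' : ℝ} (hr : r' ≤ r) {S S' : Set E} (hS : S ⊆ S') :
    truncatedCone r S ⊆ truncatedCone r' S' := by
  intro ξ hξ
  obtain ⟨l, hl, θ, hθ, h⟩ := mem_truncatedCone.mp hξ
  exact mem_truncatedCone.mpr ⟨l, hr.trans_lt hl, θ, hS hθ, h⟩

theorem isOpen_truncatedCone {r : ℝ} (hr : 0 ≤ r) {S : Set E} (hS : IsOpen S) :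
    IsOpen (truncatedCone r S) :=
  isOpen_biUnion fun _ hl => hS.smul₀ (hr.trans_lt hl).ne'

/-- Convexity is what lets `transversalOn_of_convex` apply to neighbourhoods of infinity. A convex
combination has radius `p * l₁ + q * l₂`, and its direction averages the old ones with weights
proportional to `p * l₁` and `q * l₂`. -/
theorem convex_truncatedCone {r : ℝ} (hr : 0 ≤ r) {S : Set E} (hS : Convex ℝ S) :
    Convex ℝ (truncatedCone r S) := by
  intro ξ hξ η hη p q hp hq hpq
  obtain ⟨l₁, h₁, θ₁, hθ₁, rfl⟩ := mem_truncatedCone.mp hξ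
  obtain ⟨l₂, h₂, θ₂, hθ₂, rfl⟩ := mem_truncatedCone.mp hη
  set l := p * l₁ + q * l₂ with hl
  have hlr : r < l := by
    rcases hp.eq_or_lt with rfl | hp
    · have : q = 1 := by linarith
      simpa [hl, this] using h₂
    · nlinarith [mul_lt_mul_of_pos_left h₁ hp, mul_le_mul_of_nonneg_left h₂.le hq]
  have hl0 : 0 < l := hr.trans_lt hlr
  refine mem_truncatedCone.mpr ⟨l, hlr, (p * l₁ / l) • θ₁ + (q * l₂ / l) • θ₂,
    hS hθ₁ hθ₂ ?_ ?_ ?_, ?_⟩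
  · exact div_nonneg (mul_nonneg hp (hr.trans h₁.le)) hl0.le
  · exact div_nonneg (mul_nonneg hq (hr.trans h₂.le)) hl0.le
  · rw [← add_div, ← hl, div_self hl0.ne']
  · rw [smul_add, smul_smul, smul_smul, smul_smul, smul_smul, mul_div_cancel₀ _ hl0.ne',
      mul_div_cancel₀ _ hl0.ne']

theorem mem_truncatedCone_sphere {r : ℝ} (hr : 0 ≤ r) {ξ : E} (hξ : r < ‖ξ‖) :
    ξ ∈ truncatedCone r (Metric.sphere 0 1) := by
  have h0 : ξ ≠ 0 := norm_pos_iff.mp (hr.trans_lt hξ)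
  refine mem_truncatedCone.mpr ⟨‖ξ‖, hξ, ‖ξ‖⁻¹ • ξ, ?_, ?_⟩
  · simpa using norm_smul_inv_norm (𝕜 := ℝ) h0
  · rw [smul_smul, mul_inv_cancel₀ (norm_ne_zero_iff.mpr h0), one_smul]

/-- Compactness of the sphere for properties of sets of directions and large radii. -/
theorem exists_truncatedCone_sphere {P : Set E → Prop} (hempty : P ∅)
    (hmono : ∀ S S', S ⊆ S' → P S' → P S) (hunion : ∀ S S', P S → P S' → P (S ∪ S'))
    (hloc : ∀ θ : E, ‖θ‖ = 1 → ∃ ε > 0, ∃ r, P (truncatedCone r (Metric.ball θ ε))) :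
    ∃ r : ℝ, 0 ≤ r ∧ P {ξ | r < ‖ξ‖} := by
  have key : ∃ r : ℝ, P (truncatedCone r (Metric.sphere 0 1)) := by
    refine (isCompact_sphere (0 : E) 1).induction_on
      (p := fun S => ∃ r : ℝ, P (truncatedCone r S)) ⟨0, ?_⟩ ?_ ?_ fun θ hθ => ?_
    · simpa [truncatedCone] using hempty
    · rintro S S' hS ⟨r, h⟩
      exact ⟨r, hmono _ _ (truncatedCone_mono le_rfl hS) h⟩
    · rintro S S' ⟨r, h⟩ ⟨r', h'⟩
      refine ⟨max r r', hmono _ _ ?_ (hunion _ _ h h')⟩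
      intro ξ hξ
      obtain ⟨l, hl, θ, hθ | hθ, rfl⟩ := mem_truncatedCone.mp hξ
      · exact Or.inl (mem_truncatedCone.mpr ⟨l, (le_max_left _ _).trans_lt hl, θ, hθ, rfl⟩)
      · exact Or.inr (mem_truncatedCone.mpr ⟨l, (le_max_right _ _).trans_lt hl, θ, hθ, rfl⟩)
    · obtain ⟨ε, hε, r, h⟩ := hloc θ (by simpa using hθ)
      exact ⟨_, mem_nhdsWithin_of_mem_nhds (Metric.ball_mem_nhds θ hε), r, h⟩
  obtain ⟨r, h⟩ := key
  refine ⟨max r 0, le_max_right _ _, hmono _ _ (fun ξ hξ => ?_) h⟩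
  exact truncatedCone_mono (le_max_left r 0) subset_rfl
    (mem_truncatedCone_sphere (le_max_right _ _) hξ)

theorem exists_forall_of_eventually_atTop_prod_nhds {P : ℝ × E → Prop} {θ : E}
    (h : ∀ᶠ p in atTop ×ˢ 𝓝 θ, P p) :
    ∃ ε > 0, ∃ r : ℝ, 0 ≤ r ∧ ∀ l, r < l → ∀ η ∈ Metric.ball θ ε, P (l, η) := by
  obtain ⟨pa, ha, pb, hb, hP⟩ := eventually_prod_iff.mp h
  obtain ⟨r, hr⟩ := eventually_atTop.mp ha
  obtain ⟨ε, hε, hball⟩ := Metric.eventually_nhds_iff_ball.mp hb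
  exact ⟨ε, hε, max r 0, le_max_right _ _, fun l hl η hη =>
    hP (hr l ((le_max_left _ _).trans hl.le)) (hball η hη)⟩

/-- The angle condition `1 / 2 * ‖v‖ < ⟪e, v⟫` is open and invariant under positive scaling. It
therefore passes from the limit `P θ` to the rescaled gradients nearby, and then to the gradients
themselves. -/
theorem hasTransversalCover_infinity {a : E → ℝ} (ha : ContDiff ℝ 1 a) {μ : ℝ} {P : E → E}
    (hP : ∀ θ, ‖θ‖ = 1 → P θ ≠ 0)
    (hlim : ∀ θ, ‖θ‖ = 1 → Tendsto (fun p : ℝ × E => p.1 ^ (-μ) • gradient a (p.1 • p.2))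
      (atTop ×ˢ 𝓝 θ) (𝓝 (P θ))) :
    ∃ r : ℝ, 0 ≤ r ∧ HasTransversalCover a {ξ | r < ‖ξ‖} := by
  refine exists_truncatedCone_sphere (hasTransversalCover_empty a) (fun _ _ h h' => h'.mono h)
    (fun _ _ h h' => h.union h') fun θ hθ => ?_
  set e := ‖P θ‖⁻¹ • P θ
  have hopen : IsOpen {v : E | 1 / 2 * ‖v‖ < ⟪e, v⟫_ℝ} := isOpen_lt (by fun_prop) (by fun_prop)
  obtain ⟨ε, hε, r, hr, h⟩ := exists_forall_of_eventually_atTop_prod_nhds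
    ((hlim θ hθ).eventually (hopen.mem_nhds (half_norm_lt_inner_normalize (hP θ hθ))))
  refine ⟨ε, hε, r, (transversalOn_of_convex (ha.differentiable one_ne_zero)
    (convex_truncatedCone hr (convex_ball θ ε))
    (isOpen_truncatedCone hr Metric.isOpen_ball).measurableSet
    (norm_smul_inv_norm (𝕜 := ℝ) (hP θ hθ)) (by norm_num : (0 : ℝ) < 1 / 2)
    fun ξ hξ => ?_).hasTransversalCover⟩
  obtain ⟨l, hl, η, hη, rfl⟩ := mem_truncatedCone.mp hξ
  have hl0 : 0 < l ^ (-μ) := Real.rpow_pos_of_pos (hr.trans_lt hl) _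
  have := h l hl η hη
  simp only [norm_smul, inner_smul_right, Real.norm_of_nonneg hl0.le] at this
  refine lt_of_mul_lt_mul_left ?_ hl0.le
  rwa [mul_left_comm] at this

/-- This polynomial growth is what makes the multiplier map `L²` into tempered distributions. -/
theorem norm_gradient_le_of_tendsto {a : E → ℝ} (ha : ContDiff ℝ 1 a) {μ : ℝ} (hμ : 0 ≤ μ)
    {P : E → E}
    (hlim : ∀ θ, ‖θ‖ = 1 → Tendsto (fun p : ℝ × E => p.1 ^ (-μ) • gradient a (p.1 • p.2))
      (atTop ×ˢ 𝓝 θ) (𝓝 (P θ))) :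
    ∃ A : ℝ, 0 ≤ A ∧ ∀ ξ, ‖gradient a ξ‖ ≤ A * (1 + ‖ξ‖ ^ 2) ^ (μ / 2) := by
  have key : ∃ r : ℝ, 0 ≤ r ∧ ∃ A, ∀ ξ ∈ {ξ : E | r < ‖ξ‖},
      ‖gradient a ξ‖ ≤ A * (1 + ‖ξ‖ ^ 2) ^ (μ / 2) := by
    refine exists_truncatedCone_sphere
      (P := fun S : Set E => ∃ A, ∀ ξ ∈ S, ‖gradient a ξ‖ ≤ A * (1 + ‖ξ‖ ^ 2) ^ (μ / 2))
      ⟨0, by simp⟩ (fun _ _ h ⟨A, hA⟩ => ⟨A, fun ξ hξ => hA ξ (h hξ)⟩)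
      (fun S S' ⟨A, hA⟩ ⟨A', hA'⟩ => ⟨max A A', fun ξ hξ => ?_⟩) fun θ hθ => ?_
    · rcases hξ with h | h
      · exact (hA ξ h).trans (by gcongr; exact le_max_left _ _)
      · exact (hA' ξ h).trans (by gcongr; exact le_max_right _ _)
    -- The bound `1 / 2 < ‖η‖` gives `l ≤ 2 * ‖l • η‖`, which converts powers of `l` into powers of
    -- the norm and yields the factor `2 ^ μ`.
    · have hopen : ∀ᶠ p : ℝ × E in atTop ×ˢ 𝓝 θ,
          ‖p.1 ^ (-μ) • gradient a (p.1 • p.2)‖ < ‖P θ‖ + 1 ∧ 1 / 2 < ‖p.2‖ := by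
        refine ((hlim θ hθ).norm.eventually_lt_const (lt_add_one _)).and ?_
        have : ∀ᶠ η in 𝓝 θ, 1 / 2 < ‖η‖ := continuous_norm.continuousAt.eventually_const_lt
          (by simp only [hθ]; norm_num)
        exact this.prod_inr atTop
      obtain ⟨ε, hε, r, hr, h⟩ := exists_forall_of_eventually_atTop_prod_nhds hopen
      refine ⟨ε, hε, r, (‖P θ‖ + 1) * 2 ^ μ, fun ξ hξ => ?_⟩
      obtain ⟨l, hl, η, hη, rfl⟩ := mem_truncatedCone.mp hξ
      have hl0 : 0 < l := hr.trans_lt hl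
      obtain ⟨h₁, h₂⟩ := h l hl η hη
      have hpow : 0 < l ^ μ := Real.rpow_pos_of_pos hl0 _
      rw [norm_smul, Real.norm_of_nonneg (Real.rpow_nonneg hl0.le (-μ)),
        Real.rpow_neg hl0.le, inv_mul_eq_div, div_lt_iff₀ hpow] at h₁
      refine h₁.le.trans ?_
      rw [mul_assoc]
      gcongr
      have hle : l ≤ 2 * ‖l • η‖ := by
        rw [norm_smul, Real.norm_of_nonneg hl0.le]; nlinarith
      calc l ^ μ ≤ (2 * ‖l • η‖) ^ μ := Real.rpow_le_rpow hl0.le hle hμ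
        _ = 2 ^ μ * ‖l • η‖ ^ μ := Real.mul_rpow (by norm_num) (norm_nonneg _)
        _ ≤ 2 ^ μ * (1 + ‖l • η‖ ^ 2) ^ (μ / 2) := by
          gcongr
          calc ‖l • η‖ ^ μ = (‖l • η‖ ^ 2) ^ (μ / 2) := by
                rw [← Real.rpow_natCast, ← Real.rpow_mul (norm_nonneg _)]
                congr 1; push_cast; ring
            _ ≤ _ := by gcongr; linarith
  obtain ⟨r, hr, A, hA⟩ := key
  obtain ⟨A', hA'⟩ := (isCompact_closedBall (0 : E) r).exists_bound_of_continuousOn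
    (continuous_gradient ha).continuousOn
  refine ⟨max (max A A') 0, le_max_right _ _, fun ξ => ?_⟩
  rcases lt_or_ge r ‖ξ‖ with h | h
  · refine (hA ξ h).trans ?_
    gcongr
    exact (le_max_left _ _).trans (le_max_left _ _)
  · refine (hA' ξ (by simpa using h)).trans ?_
    refine ((le_max_right A A').trans (le_max_left _ 0)).trans ?_
    refine le_mul_of_one_le_right (le_max_right _ _) ?_
    exact Real.one_le_rpow (by nlinarith [norm_nonneg ξ]) (by positivity)

end Cover

/-! ### The rescaled gradient at infinity -/

section Asymptotics

open scoped InnerProductSpace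
open Filter Topology

variable {n : ℕ}

theorem japaneseBracket_eq_rpow (x : EuclideanSpace ℝ (Fin n)) (r : ℝ) :
    japaneseBracket x ^ r = (1 + ‖x‖ ^ 2) ^ (r / 2) := by
  rw [japaneseBracket, Real.sqrt_eq_rpow, ← Real.rpow_mul (by positivity)]
  congr 1; ring

theorem le_japaneseBracket (x : EuclideanSpace ℝ (Fin n)) : ‖x‖ ≤ japaneseBracket x :=
  Real.le_sqrt_of_sq_le (by linarith)

theorem gradient_apply_eq_partialDerivative (f : EuclideanSpace ℝ (Fin n) → ℝ)
    (ξ : EuclideanSpace ℝ (Fin n)) (i : Fin n) :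
    gradient f ξ i = partialDerivative (fun _ : Fin 1 => i) f ξ := by
  rw [partialDerivative, iteratedFDeriv_one_apply, fderiv_apply_eq_inner_gradient,
    EuclideanSpace.inner_single_left]
  simp

theorem norm_le_sum_abs (v : EuclideanSpace ℝ (Fin n)) : ‖v‖ ≤ ∑ i, |v i| := by
  conv_lhs => rw [← (EuclideanSpace.basisFun (Fin n) ℝ).sum_repr v]
  refine (norm_sum_le _ _).trans (Finset.sum_le_sum fun i _ => ?_)
  rw [norm_smul]
  simp

theorem hessianMatrix_eq_zero {f : EuclideanSpace ℝ (Fin n) → ℝ} {ξ : EuclideanSpace ℝ (Fin n)}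
    (h : fderiv ℝ (fderiv ℝ f) ξ = 0) : hessianMatrix f ξ = 0 := by
  ext i j
  simp [hessianMatrix, partialDerivative, iteratedFDeriv_two_apply, h]

theorem IsHomogeneousSymbol.gradient_smul {m : ℝ} {b : EuclideanSpace ℝ (Fin n) → ℝ}
    (hb : IsHomogeneousSymbol m b) {l : ℝ} (hl : 0 < l) {ξ : EuclideanSpace ℝ (Fin n)}
    (hξ : ξ ≠ 0) : gradient b (l • ξ) = l ^ (m - 1) • gradient b ξ := by
  have hev : (fun η => b (l • η)) =ᶠ[𝓝 ξ] fun η => l ^ m * b η := by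
    filter_upwards [isOpen_compl_singleton.mem_nhds hξ] with η hη using hb.homogeneous l η hl hη
  have hd : ∀ η : EuclideanSpace ℝ (Fin n), η ≠ 0 → DifferentiableAt ℝ b η := fun η hη =>
    (hb.contDiffOn.contDiffAt (isOpen_compl_singleton.mem_nhds hη)).differentiableAt (by simp)
  have h : l • fderiv ℝ b (l • ξ) = l ^ m • fderiv ℝ b ξ := by
    rw [← fderiv_comp_smul, hev.fderiv_eq, fderiv_const_mul (hd ξ hξ)]
  have h' : fderiv ℝ b (l • ξ) = l ^ (m - 1) • fderiv ℝ b ξ := by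
    rw [Real.rpow_sub_one hl.ne', div_eq_inv_mul, mul_smul, ← h, smul_smul,
      inv_mul_cancel₀ hl.ne', one_smul]
  simp only [gradient, h', map_smulₛₗ]
  simp

theorem IsHomogeneousSymbol.continuousAt_gradient {m : ℝ} {b : EuclideanSpace ℝ (Fin n) → ℝ}
    (hb : IsHomogeneousSymbol m b) {ξ : EuclideanSpace ℝ (Fin n)} (hξ : ξ ≠ 0) :
    ContinuousAt (gradient b) ξ := by
  have h := (hb.contDiffOn.contDiffAt (isOpen_compl_singleton.mem_nhds hξ)).fderiv_right
    (m := 0) (by simp)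
  exact (InnerProductSpace.toDual ℝ _).symm.continuous.continuousAt.comp h.continuousAt

theorem IsDispersiveForLarge.exists_norm_gradient_sub_le {m : ℝ}
    {a am : EuclideanSpace ℝ (Fin n) → ℝ} (ha : Differentiable ℝ a)
    (h : IsDispersiveForLarge m a am) :
    ∃ R C : ℝ, 0 < R ∧ ∀ ξ : EuclideanSpace ℝ (Fin n), R ≤ ‖ξ‖ →
      ‖gradient a ξ - gradient am ξ‖ ≤ C * japaneseBracket ξ ^ (m - 2) := by
  obtain ⟨R, hR, hrem⟩ := h.remainder
  obtain ⟨C, hC⟩ := hrem 1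
  refine ⟨R, n * C, hR, fun ξ hξ => ?_⟩
  have h0 : ξ ≠ 0 := norm_pos_iff.mp (hR.trans_le hξ)
  have hd : DifferentiableAt ℝ am ξ := (h.principal.contDiffOn.contDiffAt
    (isOpen_compl_singleton.mem_nhds h0)).differentiableAt (by simp)
  have hsub : gradient a ξ - gradient am ξ = gradient (fun η => a η - am η) ξ := by
    simp only [gradient, fderiv_fun_sub (ha ξ) hd, map_sub]
  rw [hsub]
  refine (norm_le_sum_abs _).trans ?_
  calc ∑ i, |gradient (fun η => a η - am η) ξ i|
      ≤ ∑ _i : Fin n, C * japaneseBracket ξ ^ (m - 2) := by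
        refine Finset.sum_le_sum fun i _ => ?_
        rw [gradient_apply_eq_partialDerivative]
        have := hC (fun _ => i) ξ hξ
        rwa [show m - 1 - ((1 : ℕ) : ℝ) = m - 2 by push_cast; ring] at this
    _ = _ := by simp; ring

theorem tendsto_japaneseBracket_smul_div {θ : EuclideanSpace ℝ (Fin n)} (hθ : ‖θ‖ = 1) :
    Tendsto (fun p : ℝ × EuclideanSpace ℝ (Fin n) => japaneseBracket (p.1 • p.2) / p.1)
      (atTop ×ˢ 𝓝 θ) (𝓝 1) := by
  have h₁ : Tendsto (fun p : ℝ × EuclideanSpace ℝ (Fin n) => p.1⁻¹) (atTop ×ˢ 𝓝 θ) (𝓝 0) :=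
    tendsto_inv_atTop_zero.comp tendsto_fst
  have h₂ : Tendsto (fun p : ℝ × EuclideanSpace ℝ (Fin n) => ‖p.2‖) (atTop ×ˢ 𝓝 θ) (𝓝 1) := by
    rw [← hθ]; exact (continuous_norm.tendsto θ).comp tendsto_snd
  have h₃ := ((h₁.pow 2).add (h₂.pow 2)).sqrt
  norm_num at h₃
  refine h₃.congr' ?_
  filter_upwards [tendsto_fst.eventually (eventually_gt_atTop (0 : ℝ))] with p hp
  rw [japaneseBracket, eq_div_iff hp.ne', ← Real.sqrt_sq hp.le, ← Real.sqrt_mul (by positivity),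
    Real.sqrt_sq hp.le, norm_smul, Real.norm_of_nonneg hp.le]
  congr 1
  field_simp

/-- The gradient of the principal part is homogeneous of order `m - 1`, and the gradient of the
remainder is one order smaller. -/
theorem IsDispersiveForLarge.tendsto_gradient {m : ℝ} {a am : EuclideanSpace ℝ (Fin n) → ℝ}
    (ha : Differentiable ℝ a) (h : IsDispersiveForLarge m a am) {θ : EuclideanSpace ℝ (Fin n)}
    (hθ : ‖θ‖ = 1) :
    Tendsto (fun p : ℝ × EuclideanSpace ℝ (Fin n) => p.1 ^ (-(m - 1)) • gradient a (p.1 • p.2))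
      (atTop ×ˢ 𝓝 θ) (𝓝 (gradient am θ)) := by
  obtain ⟨R, C, hR, hC⟩ := h.exists_norm_gradient_sub_le ha
  have hθ0 : θ ≠ 0 := by rintro rfl; simp at hθ
  have hlarge : ∀ᶠ p : ℝ × EuclideanSpace ℝ (Fin n) in atTop ×ˢ 𝓝 θ,
      0 < p.1 ∧ p.2 ≠ 0 ∧ R ≤ ‖p.1 • p.2‖ := by
    have e₁ := (tendsto_fst (f := atTop (α := ℝ)) (g := 𝓝 θ)).eventually
      (eventually_ge_atTop (2 * R))
    have e₂ := (tendsto_snd (f := atTop (α := ℝ)) (g := 𝓝 θ)).eventually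
      (continuous_norm.continuousAt.eventually_const_lt (by rw [hθ]; norm_num : 1 / 2 < ‖θ‖))
    filter_upwards [e₁, e₂] with p h₁ h₂
    have h0 : 0 < p.1 := by linarith
    refine ⟨h0, norm_pos_iff.mp (by linarith), ?_⟩
    rw [norm_smul, Real.norm_of_nonneg h0.le]
    nlinarith
  have hmain : Tendsto (fun p : ℝ × EuclideanSpace ℝ (Fin n) => gradient am p.2)
      (atTop ×ˢ 𝓝 θ) (𝓝 (gradient am θ)) :=
    (h.principal.continuousAt_gradient hθ0).tendsto.comp tendsto_snd
  have hrem : Tendsto (fun p : ℝ × EuclideanSpace ℝ (Fin n) =>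
      p.1 ^ (-(m - 1)) • (gradient a (p.1 • p.2) - gradient am (p.1 • p.2)))
      (atTop ×ˢ 𝓝 θ) (𝓝 0) := by
    -- The bracket divided by `p.1` tends to 1; the spare factor `p.1⁻¹` is the gain of one order.
    have hb : Tendsto (fun p : ℝ × EuclideanSpace ℝ (Fin n) =>
        C * ((japaneseBracket (p.1 • p.2) / p.1) ^ (m - 2) * p.1⁻¹)) (atTop ×ˢ 𝓝 θ) (𝓝 0) := by
      have h₁ := (tendsto_japaneseBracket_smul_div hθ).rpow_const (p := m - 2)
        (Or.inl one_ne_zero)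
      have h₂ : Tendsto (fun p : ℝ × EuclideanSpace ℝ (Fin n) => p.1⁻¹) (atTop ×ˢ 𝓝 θ) (𝓝 0) :=
        tendsto_inv_atTop_zero.comp tendsto_fst
      simpa using (h₁.mul h₂).const_mul C
    refine squeeze_zero_norm' ?_ hb
    filter_upwards [hlarge] with p ⟨hp, _, hpR⟩
    have hJ : 0 ≤ japaneseBracket (p.1 • p.2) := Real.sqrt_nonneg _
    rw [norm_smul, Real.norm_of_nonneg (Real.rpow_nonneg hp.le _)]
    refine (mul_le_mul_of_nonneg_left (hC _ hpR) (Real.rpow_nonneg hp.le _)).trans (le_of_eq ?_)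
    rw [Real.div_rpow hJ hp.le, show -(m - 1) = -(m - 2) + -1 by ring, Real.rpow_add hp,
      Real.rpow_neg hp.le, Real.rpow_neg_one]
    ring
  have hsum := hrem.add hmain
  rw [zero_add] at hsum
  refine hsum.congr' ?_
  filter_upwards [hlarge] with p ⟨hp, hp2, _⟩
  rw [smul_sub, h.principal.gradient_smul hp hp2, smul_smul, ← Real.rpow_add hp]
  simp

/-- The lower bound on `∇a` survives rescaling and the limit along the ray through `θ`. As `m ≥ 1`,
the bracket to the power `m - 1` dominates `l ^ (m - 1)`. -/
theorem IsDispersiveForLarge.gradient_ne_zero {m : ℝ} (hm : 1 ≤ m)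
    {a am : EuclideanSpace ℝ (Fin n) → ℝ} (ha : Differentiable ℝ a)
    (h : IsDispersiveForLarge m a am) {θ : EuclideanSpace ℝ (Fin n)} (hθ : ‖θ‖ = 1) :
    gradient am θ ≠ 0 := by
  obtain ⟨c, R, hc, hR, hlow⟩ := h.gradient_lower
  have hlim : Tendsto (fun l : ℝ => l ^ (-(m - 1)) • gradient a (l • θ)) atTop
      (𝓝 (gradient am θ)) :=
    (h.tendsto_gradient ha hθ).comp (tendsto_id.prodMk tendsto_const_nhds)
  have hle : c ≤ ‖gradient am θ‖ := by
    refine ge_of_tendsto hlim.norm ?_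
    filter_upwards [eventually_ge_atTop R] with l hl
    have hl0 : 0 < l := hR.trans_le hl
    have hnorm : ‖l • θ‖ = l := by rw [norm_smul, hθ, mul_one, Real.norm_of_nonneg hl0.le]
    have hJ : l ≤ japaneseBracket (l • θ) := by
      simpa only [hnorm] using le_japaneseBracket (l • θ)
    rw [norm_smul, Real.norm_of_nonneg (Real.rpow_nonneg hl0.le _), Real.rpow_neg hl0.le,
      inv_mul_eq_div, le_div_iff₀ (Real.rpow_pos_of_pos hl0 _)]
    refine le_trans ?_ (hlow (l • θ) (by rw [hnorm]; exact hl))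
    gcongr
  exact norm_pos_iff.mp (hc.trans_le hle)

end Asymptotics

/-! ### Change of Fourier normalization and conclusion -/

section Main

open scoped InnerProductSpace

/-- The symbol `a` in the frequency variable of the Fourier transform with kernel
`e^{-2πi x·ξ}`. -/
noncomputable def rescaledSymbol {E : Type*} [NormedAddCommGroup E] [InnerProductSpace ℝ E]
    (a : E → ℝ) (ξ : E) : ℝ := (2 * Real.pi)⁻¹ * a ((2 * Real.pi) • ξ)

variable {E : Type*} [NormedAddCommGroup E] [InnerProductSpace ℝ E] [FiniteDimensional ℝ E]
  [MeasurableSpace E] [BorelSpace E]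

theorem contDiff_rescaledSymbol {a : E → ℝ} {k : ℕ∞} (ha : ContDiff ℝ k a) :
    ContDiff ℝ k (rescaledSymbol a) :=
  contDiff_const.mul (ha.comp (contDiff_const_smul _))

theorem gradient_rescaledSymbol {a : E → ℝ} (ha : Differentiable ℝ a) (ξ : E) :
    gradient (rescaledSymbol a) ξ = gradient a ((2 * Real.pi) • ξ) := by
  have hd : DifferentiableAt ℝ (fun ξ => a ((2 * Real.pi) • ξ)) ξ :=
    (ha _).comp ξ (differentiableAt_id.const_smul _)
  have h : fderiv ℝ (rescaledSymbol a) ξ = fderiv ℝ a ((2 * Real.pi) • ξ) := by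
    change fderiv ℝ (fun ξ => (2 * Real.pi)⁻¹ * a ((2 * Real.pi) • ξ)) ξ = _
    rw [fderiv_const_mul hd, fderiv_comp_smul, smul_smul,
      inv_mul_cancel₀ (by positivity), one_smul]
  simp only [gradient, h]

theorem TransversalOn.rescaledSymbol {a : E → ℝ} (ha : Differentiable ℝ a) {e : E} {c : ℝ}
    {Ω : Set E} (h : TransversalOn a e c Ω) :
    TransversalOn (rescaledSymbol a) e c ((fun ξ => (2 * Real.pi) • ξ) ⁻¹' Ω) := by
  refine ⟨h.measurableSet.preimage (measurable_const_smul _), h.norm_eq_one, h.pos,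
    fun ξ hξ => ?_, fun ξ hξ => ?_, fun ξ hξ t ht hξt heq => ?_⟩
  · rw [gradient_rescaledSymbol ha]; exact h.gradient_ne_zero _ hξ
  · rw [gradient_rescaledSymbol ha]; exact h.le_abs_inner _ hξ
  · have hpi : 0 < 2 * Real.pi := by positivity
    simp only [Set.mem_preimage, smul_add, smul_smul] at hξt
    refine h.ne_of_pos _ hξ _ (mul_pos hpi ht) hξt ?_
    have := mul_left_cancel₀ (inv_ne_zero hpi.ne') heq
    rwa [smul_add, smul_smul] at this

theorem HasTransversalCover.smoothingBoundOn {a : E → ℝ} (ha : Differentiable ℝ a)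
    (h : HasTransversalCover a Set.univ) {s : ℝ} (hs : 1 / 2 < s) :
    SmoothingBoundOn (rescaledSymbol a) s Set.univ := by
  obtain ⟨T, hT, hΩ, hsub⟩ := h
  set T' : Set (Set E) := (fun Ω => (fun ξ => (2 * Real.pi) • ξ) ⁻¹' Ω) '' T
  have hT' : T'.Finite := hT.image _
  have hΩ' : ∀ Ω ∈ T', ∃ e c, TransversalOn (rescaledSymbol a) e c Ω := by
    rintro _ ⟨Ω, h, rfl⟩
    obtain ⟨e, c, h'⟩ := hΩ Ω h
    exact ⟨e, c, h'.rescaledSymbol ha⟩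
  have hd : Differentiable ℝ (rescaledSymbol a) :=
    (ha.comp (differentiable_id.const_smul _)).const_mul _
  refine (smoothingBoundOn_sUnion hd hs hT' hΩ').univ_of_gradient_ne_zero
    (hT'.measurableSet_sUnion fun Ω h => ?_) fun ξ hξ => ?_
  · obtain ⟨e, c, h'⟩ := hΩ' Ω h
    exact h'.measurableSet
  · obtain ⟨Ω, h₁, h₂⟩ := hsub (a := (2 * Real.pi) • ξ)
      ⟨trivial, by rwa [← gradient_rescaledSymbol ha]⟩
    exact ⟨_, ⟨Ω, h₁, rfl⟩, h₂⟩

theorem exists_norm_gradient_rescaledSymbol_rpow_le {a : E → ℝ} (ha : Differentiable ℝ a)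
    {A k : ℝ} (hA0 : 0 ≤ A) (hk : 0 ≤ k) (hA : ∀ ξ, ‖gradient a ξ‖ ≤ A * (1 + ‖ξ‖ ^ 2) ^ k) :
    ∃ A' : ℝ, ∀ ξ, ‖gradient (rescaledSymbol a) ξ‖ ^ (1 / 2 : ℝ) ≤
      A' * (1 + ‖ξ‖ ^ 2) ^ (k / 2) := by
  set B : ℝ := 1 + (2 * Real.pi) ^ 2
  refine ⟨(A * B ^ k) ^ (1 / 2 : ℝ), fun ξ => ?_⟩
  have h : ‖gradient (rescaledSymbol a) ξ‖ ≤ A * B ^ k * (1 + ‖ξ‖ ^ 2) ^ k := by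
    rw [gradient_rescaledSymbol ha]
    refine (hA _).trans ?_
    rw [mul_assoc, ← Real.mul_rpow (by positivity) (by positivity)]
    gcongr
    rw [norm_smul, Real.norm_of_nonneg (by positivity), mul_pow]
    nlinarith [sq_nonneg ‖ξ‖, sq_nonneg (2 * Real.pi)]
  refine (Real.rpow_le_rpow (norm_nonneg _) h (by norm_num)).trans (le_of_eq ?_)
  rw [Real.mul_rpow (by positivity) (by positivity), ← Real.rpow_mul (by positivity)]
  congr 2; ring

/-- The prefactor `(2π)⁻¹` in `rescaledSymbol` cancels the `2π` in `Real.fourierChar`, so `t` is not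
rescaled; it also leaves the gradient unscaled. -/
theorem invariantSymbol_mul {n : ℕ} {a : EuclideanSpace ℝ (Fin n) → ℝ} (ha : Differentiable ℝ a)
    (t : ℝ) (F : EuclideanSpace ℝ (Fin n) → ℂ) (ξ : EuclideanSpace ℝ (Fin n)) :
    invariantSymbol a t ((2 * Real.pi) • ξ) * F ξ =
      Real.fourierChar (t * rescaledSymbol a ξ) • gradientSqrtMul (rescaledSymbol a) F ξ := by
  have h : Complex.exp (Complex.I * ((t * a ((2 * Real.pi) • ξ) : ℝ) : ℂ)) =
      Real.fourierChar (t * rescaledSymbol a ξ) := by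
    rw [Real.fourierChar_apply, mul_comm Complex.I, rescaledSymbol]
    congr 3
    field_simp
  rw [invariantSymbol, h, gradientSqrtMul, gradient_rescaledSymbol ha, Circle.smul_def,
    smul_eq_mul]
  ring

theorem invariantEstimate_of_smoothingBoundOn {n : ℕ} {a : EuclideanSpace ℝ (Fin n) → ℝ}
    (ha : ContDiff ℝ 1 a) {A k s : ℝ}
    (hA : ∀ ξ, ‖gradient (rescaledSymbol a) ξ‖ ^ (1 / 2 : ℝ) ≤ A * (1 + ‖ξ‖ ^ 2) ^ k)
    (h : SmoothingBoundOn (rescaledSymbol a) s Set.univ) :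
    ∃ C : ℝ≥0, ∀ φ : Lp (α := EuclideanSpace ℝ (Fin n)) ℂ 2 volume,
      InvariantEstimate a s C φ := by
  obtain ⟨C, hC⟩ := h
  have hβ : ContDiff ℝ 1 (rescaledSymbol a) := contDiff_rescaledSymbol (k := 1) ha
  have hd : Differentiable ℝ a := ha.differentiable one_ne_zero
  have hgrad := continuous_gradient hβ
  refine ⟨C, fun φ => ?_⟩
  set F : Lp (α := EuclideanSpace ℝ (Fin n)) ℂ 2 volume := 𝓕 φ with hF
  have hnorm : ‖F‖ₑ = ‖φ‖ₑ := by
    rw [← ofReal_norm, ← ofReal_norm, hF, Lp.norm_fourier_eq]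
  have hσ : ∀ t, Continuous fun ξ : EuclideanSpace ℝ (Fin n) =>
      invariantSymbol a t ((2 * Real.pi) • ξ) := fun t => by
    have h₁ : Continuous fun ξ => Real.fourierChar (t * rescaledSymbol a ξ) •
        gradientSqrtMul (rescaledSymbol a) (fun _ => 1) ξ := by
      refine (Real.continuous_fourierChar.comp (hβ.continuous.const_mul t)).smul ?_
      exact (Complex.continuous_ofReal.comp
        (hgrad.norm.rpow_const fun _ => Or.inr (by norm_num))).mul continuous_const
    refine h₁.congr fun ξ => ?_
    rw [← invariantSymbol_mul hd, mul_one]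
  have hσA : ∀ t ξ, ‖invariantSymbol a t ((2 * Real.pi) • ξ)‖ ≤ A * (1 + ‖ξ‖ ^ 2) ^ k := by
    intro t ξ
    have := invariantSymbol_mul hd t (fun _ => 1) ξ
    rw [mul_one] at this
    rw [this, Circle.norm_smul, gradientSqrtMul, mul_one, Complex.norm_real,
      Real.norm_of_nonneg (by positivity)]
    exact hA ξ
  choose S hS using fun t => exists_temperedDistribution_of_growth (hσ t) (hσA t) F
  obtain ⟨v, hvm, hvle, hv⟩ := exists_evolution_limit hβ.continuous hgrad hA
    (fun f hf hg => hC f hf hg fun ξ hξ => absurd trivial hξ) F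
  -- The distribution is defined on the frequency side for every `t`; the function `v` represents it
  -- for almost every `t`.
  refine ⟨fun t => 𝓕⁻ (S t), fun t χ => ?_, v, hvm.aestronglyMeasurable, ?_, ?_⟩
  · rw [FourierTransform.fourier_fourierInv_eq]
    exact hS t χ
  · filter_upwards [hv] with t ht ψ
    refine ⟨(ht ψ).1, ?_⟩
    rw [(ht ψ).2, TemperedDistribution.fourierInv_apply, (hS t _).2]
    simp_rw [invariantSymbol_mul hd]
  · simp_rw [japaneseBracket_eq_rpow]
    rw [← hnorm]
    exact hvle

end Main

theorem theorem6p5 (n : ℕ) (hn : 1 ≤ n) (m s : ℝ) (hm : 1 ≤ m) (hs : 1 / 2 < s)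
    (a am : EuclideanSpace ℝ (Fin n) → ℝ)
    (ha : ContDiff ℝ ∞ a)
    (hfin : {ξ : EuclideanSpace ℝ (Fin n) | gradient a ξ = 0}.Finite)
    (hdisp : IsDispersiveForLarge m a am)
    (hnondeg : ∀ ξ : EuclideanSpace ℝ (Fin n), gradient a ξ = 0 → (hessianMatrix a ξ).det ≠ 0) :
    ∃ C : ℝ≥0, ∀ φ : Lp (α := EuclideanSpace ℝ (Fin n)) ℂ 2 volume,
      InvariantEstimate a s C φ := by
  have : NeZero n := ⟨by omega⟩
  have h₂ : ContDiff ℝ 2 a := by exact_mod_cast contDiff_infty.mp ha 2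
  have h₁ : ContDiff ℝ 1 a := h₂.of_le one_le_two
  have hd : Differentiable ℝ a := h₁.differentiable one_ne_zero
  have hlim := fun θ (hθ : ‖θ‖ = 1) => hdisp.tendsto_gradient hd hθ
  have hcrit : ∀ ξ, gradient a ξ = 0 → fderiv ℝ (fderiv ℝ a) ξ ≠ 0 := fun ξ hξ h =>
    hnondeg ξ hξ (by rw [hessianMatrix_eq_zero h, Matrix.det_zero])
  obtain ⟨r, _, hinf⟩ := hasTransversalCover_infinity h₁
    (fun θ hθ => hdisp.gradient_ne_zero hm hd hθ) hlim
  have hcover : HasTransversalCover a Set.univ := by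
    refine (hinf.union (hasTransversalCover_of_isCompact h₂ hcrit
      (isCompact_closedBall (0 : EuclideanSpace ℝ (Fin n)) r))).mono fun ξ _ => ?_
    simpa using lt_or_ge r ‖ξ‖
  obtain ⟨A, hA0, hA⟩ := norm_gradient_le_of_tendsto h₁ (sub_nonneg.mpr hm) hlim
  obtain ⟨A', hA'⟩ := exists_norm_gradient_rescaledSymbol_rpow_le hd hA0
    (by linarith : 0 ≤ (m - 1) / 2) hA
  exact invariantEstimate_of_smoothingBoundOn h₁ hA' (hcover.smoothingBoundOn hd hs)
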